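/- **Setting.** Let $k\ge 0$ be an integer, write $\dagger$ for the adjoint of a complex $k\times k$ matrix, and let $d\mu=A\,d\mu_t$ be a normalized positive $k\times k$ matrix-valued measure on the unit circle $\partial\mathbb D$: $\mu_t$ is a finite positive scalar measure, $A$ is measurable, $A\ge 0$ and $\operatorname{Tr}A=1$ $\mu_t$-a.e., and $\int A\,d\mu_t=\mathbf 1$. For functions $f,g:\partial\mathbb D\to\mathbb C^{k\times k}$ put $$\langle\!\langle f,g\rangle\!\rangle_{R}=\int f^\dagger A\,g\,d\mu_t,\qquad \langle\!\langle f,g\rangle\!\rangle_{L}=\int g\,A f^\dagger\,d\mu_t .$$ Assume $\mu$ is nontrivial: for every $n$ and $B_0,\dots,B_{n-1}\in\mathbb C^{k\times k}$, if $f=\sum_{\ell<n}B_\ell z^\ell$ satisfies $\int\operatorname{Tr}(f^\dagger A f)\,d\mu_t=0$, then all $B_\ell=0$. For a polynomial $P$ of degree at most $n$ with matrix coefficients, let $P^*(z)=z^nP(1/\bar z)^\dagger$ (with $n$ the index of $\varphi_n$ when applied to $\varphi_n$). For $\alpha\in\mathbb C^{k\times k}$ with $\|\alpha\|<1$ put $\rho^L=(1-\alpha^\dagger\alpha)^{1/2}$,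 $\rho^R=(1-\alpha\alpha^\dagger)^{1/2}$ and $$\Theta(\alpha)=\begin{pmatrix}\alpha^\dagger&\rho^L\\ \rho^R&-\alpha\end{pmatrix}.$$ **Theorem 4.2** (with Proposition 4.1). 1. There are a unique sequence $(\varphi^L_n)_{n\ge0}$ and a unique sequence $(\varphi^R_n)_{n\ge 0}$ of matrix polynomials $\varphi_n^{L}=\kappa^{L}_nz^n+\text{lower order}$, $\varphi_n^{R}=\kappa^{R}_nz^n+\text{lower order}$ with $\langle\!\langle\varphi^L_n,\varphi^L_m\rangle\!\rangle_L=\delta_{nm}\mathbf 1$, $\langle\!\langle\varphi^R_n,\varphi^R_m\rangle\!\rangle_R=\delta_{nm}\mathbf 1$, $\kappa^L_0=\kappa^R_0=\mathbf 1$, $\kappa^L_{n+1}(\kappa^L_n)^{-1}>0$, $(\kappa^R_n)^{-1}\kappa^R_{n+1}>0$. There is a unique sequence $(\alpha_n)_{n\ge0}$ of $k\times k$ matrices (the Verblunsky coefficients) with $\|\alpha_n\|<1$ such that for all $n$, with $\rho_n^L,\rho_n^R$ formed from $\alpha_n$, $$z\varphi^L_n=\rho^L_n\varphi^L_{n+1}+\alpha_n^\dagger(\varphi^R_n)^*,\qquad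 z\varphi^R_n=\varphi^R_{n+1}\rho^R_n+(\varphi^L_n)^*\alpha_n^\dagger,$$ $$(\varphi^L_n)^*=(\varphi^L_{n+1})^*\rho^L_n+z\varphi^R_n\alpha_n,\qquad (\varphi^R_n)^*=\rho^R_n(\varphi^R_{n+1})^*+\alpha_nz\varphi^L_n .$$ 2. Define the left-handed CMV and alternate CMV functions by $$\chi_{2m}=z^{-m}(\varphi^R_{2m})^*,\quad \chi_{2m-1}=z^{-m+1}\varphi^L_{2m-1},\quad x_{2m}=z^{-m}\varphi^L_{2m},\quad x_{2m-1}=z^{-m}(\varphi^R_{2m-1})^*,$$ and the right-handed ones $\tilde\chi_\ell,\tilde x_\ell$ by the same formulas with $L$ and $R$ interchanged. Then, for all $\ell,m\ge 0$, $$\langle\!\langle\chi_\ell,\chi_m\rangle\!\rangle_L=\langle\!\langle x_\ell,x_m\rangle\!\rangle_L=\langle\!\langle\tilde\chi_\ell,\tilde\chi_m\rangle\!\rangle_R=\langle\!\langle\tilde x_\ell,\tilde x_m\rangle\!\rangle_R=\delta_{\ell m}\mathbf 1 .$$ Moreover $\chi_\ell$ and $\tilde\chi_\ell$ are combinations, with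 constant $k\times k$ matrix coefficients, of the first $\ell+1$ of $1,z,z^{-1},z^2,z^{-2},\dots$, and $x_\ell$ and $\tilde x_\ell$ of the first $\ell+1$ of $1,z^{-1},z,z^{-2},z^2,\dots$. 3. Each $\Theta(\alpha_n)$ is a unitary $2k\times 2k$ matrix. Define semi-infinite matrices of $k\times k$ blocks by $$\mathcal C_{j\ell}=\langle\!\langle\tilde\chi_j,z\tilde\chi_\ell\rangle\!\rangle_R,\qquad \mathcal L_{j\ell}=\langle\!\langle\tilde\chi_j,z\tilde x_\ell\rangle\!\rangle_R,\qquad \mathcal M_{j\ell}=\langle\!\langle\tilde x_j,\tilde\chi_\ell\rangle\!\rangle_R\qquad(j,\ell\ge0).$$ Then $\mathcal C=\mathcal L\mathcal M$, that is $\mathcal C_{j\ell}=\sum_m\mathcal L_{jm}\mathcal M_{m\ell}$ with only finitely many nonzero terms, and $$\mathcal M=\mathbf 1\oplus\Theta_1(\alpha_1)\oplus\Theta_3(\alpha_3)\oplus\cdots,\qquad \mathcal L=\Theta_0(\alpha_0)\oplus\Theta_2(\alpha_2)\oplus\Theta_4(\alpha_4)\oplus\cdots,$$ where $\Theta_j(\alpha_j)=\Theta(\alpha_j)$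 placed in block rows and columns $j,j+1$, and $\mathbf 1$ is the $k\times k$ identity in block position $(0,0)$. 4. The left-handed functions give the same factors once block rows and columns are exchanged (left-module coordinates are row vectors): for all $j,\ell$, $$\langle\!\langle\chi_\ell,zx_j\rangle\!\rangle_L=\mathcal L_{j\ell},\qquad \langle\!\langle x_\ell,\chi_j\rangle\!\rangle_L=\mathcal M_{j\ell},$$ $$\langle\!\langle x_\ell,zx_j\rangle\!\rangle_L=(\mathcal L\mathcal M)_{j\ell},\qquad \langle\!\langle\chi_\ell,z\chi_j\rangle\!\rangle_L=(\mathcal M\mathcal L)_{j\ell},$$ again with only finitely many nonzero terms in each block of the products. -/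

import Mathlib

open MeasureTheory Polynomial
open scoped ComplexOrder MatrixOrder

noncomputable section

namespace MatrixCMV

instance instMeasurableSpaceCircle : MeasurableSpace Circle := borel Circle

instance instBorelSpaceCircle : BorelSpace Circle := ⟨rfl⟩

/-- The `k × k` complex matrices. -/
abbrev Mat (k : ℕ) : Type := Matrix (Fin k) (Fin k) ℂ

/-- A normalized positive `k × k` matrix-valued measure `dμ = A dμ_t` on the unit circle: a finite
positive scalar measure `μ_t` and a measurable density `A` with `A ≥ 0`, `Tr A = 1` almost
everywhere and `∫ A dμ_t = 1`. -/
structure MatrixMeasure (k : ℕ) where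
  scalar : Measure Circle
  finite : IsFiniteMeasure scalar
  density : Circle → Mat k
  aemeasurable : ∀ i j, AEMeasurable (fun z => density z i j) scalar
  posSemidef : ∀ᵐ z ∂scalar, (density z).PosSemidef
  trace_eq_one : ∀ᵐ z ∂scalar, (density z).trace = 1
  normalized : ∀ i j, ∫ z, density z i j ∂scalar = (1 : Mat k) i j

attribute [instance] MatrixMeasure.finite

variable {k : ℕ}

/-- `⟨⟨f, g⟩⟩_R = ∫ f† dμ g`, a `k × k` matrix, integrated entry by entry. -/
def innerR (μ : MatrixMeasure k) (f g : Circle → Mat k) : Mat k :=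
  Matrix.of fun i j => ∫ z, ((f z).conjTranspose * μ.density z * g z) i j ∂μ.scalar

/-- `⟨⟨f, g⟩⟩_L = ∫ g dμ f†`, a `k × k` matrix, integrated entry by entry. -/
def innerL (μ : MatrixMeasure k) (f g : Circle → Mat k) : Mat k :=
  Matrix.of fun i j => ∫ z, (g z * μ.density z * (f z).conjTranspose) i j ∂μ.scalar

/-- Nontriviality: if `f = ∑_{ℓ < n} B_ℓ z^ℓ` vanishes in `H_R`, that is
`∫ Tr (f† A f) dμ_t = 0`, then all the `B_ℓ` vanish. -/
def MatrixMeasure.Nontrivial (μ : MatrixMeasure k) : Prop :=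
  ∀ (n : ℕ) (B : Fin n → Mat k),
    (innerR μ (fun z => ∑ l : Fin n, (z : ℂ) ^ (l : ℕ) • B l)
      (fun z => ∑ l : Fin n, (z : ℂ) ^ (l : ℕ) • B l)).trace = 0 → ∀ l, B l = 0

/-- The value `∑ c_j z^j` on the circle of a polynomial `∑ c_j X^j` with matrix coefficients. -/
def evalCircle (P : (Mat k)[X]) (z : Circle) : Mat k :=
  P.sum fun j c => (z : ℂ) ^ j • c

/-- The Szegő dual `P^*(z) = z^n P(1 / z̄)†` of a polynomial of degree at most `n`, that is
`∑_{j ≤ n} c_{n-j}† X^j` for `P = ∑_{j ≤ n} c_j X^j`. -/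
def szegoDual (n : ℕ) (P : (Mat k)[X]) : (Mat k)[X] :=
  ∑ j ∈ Finset.range (n + 1), monomial j (P.coeff (n - j)).conjTranspose

/-- The normalized left orthogonal polynomials: `φ_n = κ_n z^n + lower order`,
`⟨⟨φ_n, φ_m⟩⟩_L = δ_{nm} 1`, with `κ_0 = 1` and `κ_{n+1} κ_n⁻¹ > 0`. -/
structure IsLeftOPUC (μ : MatrixMeasure k) (φ : ℕ → (Mat k)[X]) : Prop where
  natDegree_le : ∀ n, (φ n).natDegree ≤ n
  orthonormal : ∀ n m,
    innerL μ (evalCircle (φ n)) (evalCircle (φ m)) = if n = m then 1 else 0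
  leading_zero : (φ 0).coeff 0 = 1
  leading_succ : ∀ n, ((φ (n + 1)).coeff (n + 1) * ((φ n).coeff n)⁻¹).PosDef

/-- The normalized right orthogonal polynomials: `φ_n = κ_n z^n + lower order`,
`⟨⟨φ_n, φ_m⟩⟩_R = δ_{nm} 1`, with `κ_0 = 1` and `κ_n⁻¹ κ_{n+1} > 0`. -/
structure IsRightOPUC (μ : MatrixMeasure k) (φ : ℕ → (Mat k)[X]) : Prop where
  natDegree_le : ∀ n, (φ n).natDegree ≤ n
  orthonormal : ∀ n m,
    innerR μ (evalCircle (φ n)) (evalCircle (φ m)) = if n = m then 1 else 0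
  leading_zero : (φ 0).coeff 0 = 1
  leading_succ : ∀ n, (((φ n).coeff n)⁻¹ * (φ (n + 1)).coeff (n + 1)).PosDef

/-- `ρ^L = (1 - α† α)^{1/2}`. -/
def rhoL (α : Mat k) : Mat k := CFC.sqrt (1 - α.conjTranspose * α)

/-- `ρ^R = (1 - α α†)^{1/2}`. -/
def rhoR (α : Mat k) : Mat k := CFC.sqrt (1 - α * α.conjTranspose)

/-- `α` is the sequence of Verblunsky coefficients attached to `φ^L`, `φ^R`: every `α_n` has
operator norm less than one, and the four Szegő recursion relations hold. -/
structure IsVerblunsky (φL φR : ℕ → (Mat k)[X]) (α : ℕ → Mat k) : Prop where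
  norm_lt_one : ∀ n, ‖Matrix.toEuclideanCLM (n := Fin k) (𝕜 := ℂ) (α n)‖ < 1
  left : ∀ n, X * φL n =
    C (rhoL (α n)) * φL (n + 1) + C (α n).conjTranspose * szegoDual n (φR n)
  right : ∀ n, X * φR n =
    φR (n + 1) * C (rhoR (α n)) + szegoDual n (φL n) * C (α n).conjTranspose
  left_dual : ∀ n, szegoDual n (φL n) =
    szegoDual (n + 1) (φL (n + 1)) * C (rhoL (α n)) + X * φR n * C (α n)
  right_dual : ∀ n, szegoDual n (φR n) =
    C (rhoR (α n)) * szegoDual (n + 1) (φR (n + 1)) + C (α n) * (X * φL n)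

/-- The CMV functions built from two sequences of polynomials:
`χ_{2m} = z^{-m} (ψ_{2m})^*` and `χ_{2m-1} = z^{-m+1} φ_{2m-1}`.
In both cases the exponent of `z` is `-⌊ℓ/2⌋`. -/
def cmvChi (φ ψ : ℕ → (Mat k)[X]) (l : ℕ) (z : Circle) : Mat k :=
  (z : ℂ) ^ (-((l / 2 : ℕ) : ℤ)) •
    (if Even l then evalCircle (szegoDual l (ψ l)) z else evalCircle (φ l) z)

/-- The alternate CMV functions built from two sequences of polynomials:
`x_{2m} = z^{-m} φ_{2m}` and `x_{2m-1} = z^{-m} (ψ_{2m-1})^*`.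
In both cases the exponent of `z` is `-⌊(ℓ+1)/2⌋`. -/
def cmvX (φ ψ : ℕ → (Mat k)[X]) (l : ℕ) (z : Circle) : Mat k :=
  (z : ℂ) ^ (-(((l + 1) / 2 : ℕ) : ℤ)) •
    (if Even l then evalCircle (φ l) z else evalCircle (szegoDual l (ψ l)) z)

/-- Multiplication of a matrix-valued function by `z`. -/
def mulZ (f : Circle → Mat k) (z : Circle) : Mat k := (z : ℂ) • f z

/-- The exponents `0, 1, -1, 2, -2, …` of the sequence `1, z, z⁻¹, z², z⁻², …`. -/
def cmvExponent (j : ℕ) : ℤ := if Even j then -((j / 2 : ℕ) : ℤ) else ((j + 1) / 2 : ℕ)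

/-- `f` lies in the module span of `z^{e_0}, …, z^{e_{n-1}}`: `f = ∑_{j < n} B_j z^{e_j}` with
constant matrices `B_j`. -/
def InModuleSpan (e : ℕ → ℤ) (n : ℕ) (f : Circle → Mat k) : Prop :=
  ∃ B : Fin n → Mat k, ∀ z : Circle, f z = ∑ j : Fin n, (z : ℂ) ^ e j • B j

/-- `Θ(α)` as a `2 × 2` matrix of `k × k` blocks. -/
def theta (α : Mat k) : Matrix (Fin 2) (Fin 2) (Mat k) :=
  !![α.conjTranspose, rhoL α; rhoR α, -α]

/-- `Θ(α)` as a `2k × 2k` complex matrix. -/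
def thetaFull (α : Mat k) : Matrix (Fin 2 × Fin k) (Fin 2 × Fin k) ℂ :=
  Matrix.comp (Fin 2) (Fin 2) (Fin k) (Fin k) ℂ (theta α)

/-- The semi-infinite block matrix `T_0 ⊕ T_1 ⊕ T_2 ⊕ ⋯`, where `T_i` occupies the block rows and
columns `2i, 2i+1`. -/
def directSum (T : ℕ → Matrix (Fin 2) (Fin 2) (Mat k)) : Matrix ℕ ℕ (Mat k) :=
  Matrix.of fun j l =>
    if j / 2 = l / 2 then T (j / 2) (Fin.ofNat 2 j) (Fin.ofNat 2 l) else 0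

/-- The semi-infinite block matrix `1 ⊕ S`, with the `k × k` identity in the corner. -/
def oneDirectSum (S : Matrix ℕ ℕ (Mat k)) : Matrix ℕ ℕ (Mat k) :=
  Matrix.of fun j l =>
    match j, l with
    | 0, 0 => 1
    | j + 1, l + 1 => S j l
    | _, _ => 0

/-- `Θ_0(α_0) ⊕ Θ_2(α_2) ⊕ Θ_4(α_4) ⊕ ⋯`. -/
def blockL (α : ℕ → Mat k) : Matrix ℕ ℕ (Mat k) := directSum fun i => theta (α (2 * i))

/-- `1 ⊕ Θ_1(α_1) ⊕ Θ_3(α_3) ⊕ ⋯`. -/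
def blockM (α : ℕ → Mat k) : Matrix ℕ ℕ (Mat k) :=
  oneDirectSum (directSum fun i => theta (α (2 * i + 1)))

/-- `P` is the product `S T` of semi-infinite block matrices: `P_{jl} = ∑_m S_{jm} T_{ml}`, where
for fixed `j, l` only finitely many summands are nonzero. -/
def IsBlockProduct (P S T : Matrix ℕ ℕ (Mat k)) : Prop :=
  ∀ j l, (Function.support fun m => S j m * T m l).Finite ∧ P j l = ∑ᶠ m, S j m * T m l

/-- The block matrix `⟨⟨f_j, g_l⟩⟩_R`, `j` indexing the block rows. Since `⟨⟨·, ·⟩⟩_R` is linear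
for multiplication by constants from the right, this is the matrix, in right-module coordinates, of
the `g_l` with respect to the `f_j`. -/
def gramR (μ : MatrixMeasure k) (f g : ℕ → Circle → Mat k) : Matrix ℕ ℕ (Mat k) :=
  Matrix.of fun j l => innerR μ (f j) (g l)

/-- The block matrix `⟨⟨f_l, g_j⟩⟩_L`, `j` indexing the block rows. Since `⟨⟨·, ·⟩⟩_L` is linear
for multiplication by constants from the left, coordinates are row vectors and row `j` of this
matrix holds the coordinates of `g_j` with respect to the `f_l`. -/
def gramL (μ : MatrixMeasure k) (f g : ℕ → Circle → Mat k) : Matrix ℕ ℕ (Mat k) :=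
  Matrix.of fun j l => innerL μ (f l) (g j)

end MatrixCMV

end

/-
Everything takes place in the right inner product, where multiplication by `z` is an isometry.
There `φ^R_n` is the normalized residual of `z^n` modulo `1, …, z^(n-1)` and, after taking
adjoints, `(φ^L_n)^*` is the normalized residual of `1` modulo `z, …, z^n`. Hence `z φ^R_n` and
`(φ^L_n)^*` are normalized residuals of `z^(n+1)` and of `1` modulo the same monomials `z, …, z^n`,
and subtracting from each its projection on the other produces the next pair. The only datum of
this step is `α_n = ⟨⟨z φ^R_n, (φ^L_n)^*⟩⟩_R`, and nontriviality of the measure is what makes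
`‖α_n‖ < 1`. Multiplied by a power of `z`, the same residuals orthonormalize `1, z, z⁻¹, …` and `1,
z⁻¹, z, …`, and solving the recursion for `z φ^R_n` and `(φ^L_{n+1})^*` in terms of `(φ^L_n)^*` and
`φ^R_{n+1}` gives the two columns of `Θ(α_n)`. On the circle the adjoint of `χ_l` is `x̃_l` and
that of `x_l` is `χ̃_l`, which carries the right-handed statements over to the left-handed ones.
-/

noncomputable section

namespace MatrixCMV

section PositiveDefinite

variable {m n 𝕜 : Type*} [Fintype m] [Fintype n] [RCLike 𝕜]

lemma norm_apply_le_trace_of_posSemidef {A : Matrix n n 𝕜} (hA : A.PosSemidef) (i j : n) :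
    ‖A i j‖ ≤ RCLike.re A.trace := by
  classical
  obtain ⟨B, rfl⟩ := CStarAlgebra.nonneg_iff_eq_star_mul_self.1 hA.nonneg
  let c (l : n) : EuclideanSpace 𝕜 n := WithLp.toLp 2 (B.col l)
  have entry (a b : n) : (star B * B) a b = inner 𝕜 (c a) (c b) := by
    rw [EuclideanSpace.inner_eq_star_dotProduct, dotProduct_comm]
    rfl
  have trace_eq : RCLike.re (star B * B).trace = ∑ l, ‖c l‖ ^ 2 := by
    simp only [Matrix.trace, Matrix.diag_apply, entry, map_sum, inner_self_eq_norm_sq]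
  have le_trace (l : n) : ‖c l‖ ^ 2 ≤ RCLike.re (star B * B).trace :=
    trace_eq ▸ Finset.single_le_sum (f := fun l => ‖c l‖ ^ 2) (fun _ _ => sq_nonneg _)
      (Finset.mem_univ l)
  calc ‖(star B * B) i j‖ ≤ ‖c i‖ * ‖c j‖ := entry i j ▸ norm_inner_le_norm _ _
    _ ≤ (‖c i‖ ^ 2 + ‖c j‖ ^ 2) / 2 := by linarith [two_mul_le_add_sq ‖c i‖ ‖c j‖]
    _ ≤ RCLike.re (star B * B).trace := by linarith [le_trace i, le_trace j]

lemma posDef_sqrt [DecidableEq n] {A : Matrix n n 𝕜} (hA : A.PosDef) : (CFC.sqrt A).PosDef :=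
  Matrix.isStrictlyPositive_iff_posDef.1 hA.isStrictlyPositive.sqrt

lemma eq_zero_of_mul_add_mul_eq_zero {S : Matrix n n 𝕜} {T : Matrix m m 𝕜} {Y : Matrix n m 𝕜}
    (hS : S.PosDef) (hT : T.PosSemidef) (h : S * Y + Y * T = 0) : Y = 0 := by
  classical
  have trace_add : (Y.conjTranspose * S * Y).trace + (Y * T * Y.conjTranspose).trace = 0 := by
    rw [Matrix.trace_mul_comm (Y * T), ← Matrix.trace_add, Matrix.mul_assoc, ← Matrix.mul_add, h,
      Matrix.mul_zero, Matrix.trace_zero]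
  have trace_zero : (Y.conjTranspose * S * Y).trace = 0 :=
    ((add_eq_zero_iff_of_nonneg (hS.posSemidef.conjTranspose_mul_mul_same Y).trace_nonneg
      (hT.mul_mul_conjTranspose_same Y).trace_nonneg).1 trace_add).1
  have sqrt_mul_eq : CFC.sqrt S * Y = 0 := by
    rw [← Matrix.trace_conjTranspose_mul_self_eq_zero_iff, Matrix.conjTranspose_mul,
      (posDef_sqrt hS).isHermitian.eq, Matrix.mul_assoc, ← Matrix.mul_assoc (CFC.sqrt S),
      CFC.sqrt_mul_sqrt_self S hS.posSemidef.nonneg, ← Matrix.mul_assoc, trace_zero]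
  rw [← Matrix.nonsing_inv_mul_cancel_left (CFC.sqrt S) Y
    ((Matrix.isUnit_iff_isUnit_det _).1 (posDef_sqrt hS).isUnit), sqrt_mul_eq, Matrix.mul_zero]

lemma eq_one_of_posDef_mul [DecidableEq n] {P U : Matrix n n 𝕜} (hP : P.PosDef)
    (hPU : (P * U).PosDef) (hU : U ∈ Matrix.unitaryGroup n 𝕜) : U = 1 := by
  have sq_eq : (P * U) * (P * U) = P * P := by
    calc (P * U) * (P * U) = (P * U) * (P * U).conjTranspose := by rw [hPU.isHermitian.eq]
      _ = P * (U * star U) * P := by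
        rw [Matrix.conjTranspose_mul, hP.isHermitian.eq, Matrix.star_eq_conjTranspose]
        simp only [mul_assoc]
      _ = P * P := by rw [Matrix.mem_unitaryGroup_iff.1 hU, mul_one]
  have mul_eq : P * U = P :=
    (CFC.mul_self_eq_mul_self_iff _ _ hPU.posSemidef.nonneg hP.posSemidef.nonneg).1 sq_eq
  exact hP.isUnit.mul_left_cancel (by rw [mul_eq, mul_one])

end PositiveDefinite

section StrictContraction

lemma isStrictlyPositive_one_sub_star_mul_self_iff {A : Type*} [CStarAlgebra A] [PartialOrder A]
    [StarOrderedRing A] {a : A} : IsStrictlyPositive (1 - star a * a) ↔ ‖a‖ < 1 := by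
  rcases subsingleton_or_nontrivial A with _ | _
  · simp [Subsingleton.elim a 0]
  have norm_sq : ‖star a * a‖ = ‖a‖ * ‖a‖ := CStarRing.norm_star_mul_self
  refine ⟨fun h => ?_, fun h => ?_⟩
  · have norm_le : ‖star a * a‖ ≤ 1 :=
      (CStarAlgebra.norm_le_one_iff_of_nonneg _ (star_mul_self_nonneg a)).2 (sub_nonneg.1 h.nonneg)
    have norm_ne : ‖star a * a‖ ≠ 1 := fun h1 => by
      have mem := CStarAlgebra.norm_mem_spectrum_of_nonneg (star_mul_self_nonneg a)
      rw [h1, spectrum.mem_iff, map_one] at mem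
      exact mem h.isUnit
    nlinarith [lt_of_le_of_ne norm_le norm_ne, norm_nonneg a]
  · have norm_lt : ‖star a * a‖ < 1 := by nlinarith [norm_nonneg a]
    exact (isUnit_one_sub_of_norm_lt_one norm_lt).isStrictlyPositive
      (sub_nonneg.2 ((CStarAlgebra.norm_le_one_iff_of_nonneg _ (star_mul_self_nonneg a)).1
        norm_lt.le))

variable {k : ℕ} {α : Mat k}

open scoped Matrix.Norms.L2Operator in
lemma posDef_one_sub_conjTranspose_mul_self_iff :
    (1 - α.conjTranspose * α).PosDef ↔
      ‖Matrix.toEuclideanCLM (n := Fin k) (𝕜 := ℂ) α‖ < 1 := by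
  rw [Matrix.l2_opNorm_toEuclideanCLM, ← isStrictlyPositive_one_sub_star_mul_self_iff,
    Matrix.isStrictlyPositive_iff_posDef, Matrix.star_eq_conjTranspose]

open scoped Matrix.Norms.L2Operator in
lemma posDef_one_sub_mul_conjTranspose_self_iff :
    (1 - α * α.conjTranspose).PosDef ↔
      ‖Matrix.toEuclideanCLM (n := Fin k) (𝕜 := ℂ) α‖ < 1 := by
  rw [Matrix.l2_opNorm_toEuclideanCLM, ← norm_star, ← Matrix.l2_opNorm_toEuclideanCLM,
    ← posDef_one_sub_conjTranspose_mul_self_iff, Matrix.star_eq_conjTranspose,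
    Matrix.conjTranspose_conjTranspose]

lemma rhoR_conjTranspose (α : Mat k) : rhoR α.conjTranspose = rhoL α := by
  rw [rhoR, rhoL, Matrix.conjTranspose_conjTranspose]

variable (hα : ‖Matrix.toEuclideanCLM (n := Fin k) (𝕜 := ℂ) α‖ < 1)
include hα

lemma posDef_rhoL : (rhoL α).PosDef :=
  posDef_sqrt (posDef_one_sub_conjTranspose_mul_self_iff.2 hα)

lemma posDef_rhoR : (rhoR α).PosDef :=
  posDef_sqrt (posDef_one_sub_mul_conjTranspose_self_iff.2 hα)

lemma rhoL_mul_self : rhoL α * rhoL α = 1 - α.conjTranspose * α :=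
  CFC.sqrt_mul_sqrt_self _ (posDef_one_sub_conjTranspose_mul_self_iff.2 hα).posSemidef.nonneg

lemma rhoR_mul_self : rhoR α * rhoR α = 1 - α * α.conjTranspose :=
  CFC.sqrt_mul_sqrt_self _ (posDef_one_sub_mul_conjTranspose_self_iff.2 hα).posSemidef.nonneg

lemma rhoR_mul_eq_mul_rhoL : rhoR α * α = α * rhoL α := by
  refine sub_eq_zero.1 (eq_zero_of_mul_add_mul_eq_zero (posDef_rhoR hα)
    (posDef_rhoL hα).posSemidef ?_)
  calc rhoR α * (rhoR α * α - α * rhoL α) + (rhoR α * α - α * rhoL α) * rhoL α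
      = rhoR α * rhoR α * α - α * (rhoL α * rhoL α) := by noncomm_ring
    _ = 0 := by
      rw [rhoR_mul_self hα, rhoL_mul_self hα]
      noncomm_ring

lemma conjTranspose_mul_rhoR : α.conjTranspose * rhoR α = rhoL α * α.conjTranspose := by
  simpa only [Matrix.conjTranspose_mul, (posDef_rhoR hα).isHermitian.eq,
    (posDef_rhoL hα).isHermitian.eq] using congrArg Matrix.conjTranspose (rhoR_mul_eq_mul_rhoL hα)

lemma thetaFull_mem_unitaryGroup : thetaFull α ∈ Matrix.unitaryGroup (Fin 2 × Fin k) ℂ := by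
  have star_rhoL : star (rhoL α) = rhoL α := (posDef_rhoL hα).isHermitian
  have star_rhoR : star (rhoR α) = rhoR α := (posDef_rhoR hα).isHermitian
  have star_eq : star (theta α) = !![α, rhoR α; rhoL α, -α.conjTranspose] := by
    ext i j : 1
    fin_cases i <;> fin_cases j <;>
      simp [theta, star_rhoL, star_rhoR, ← Matrix.star_eq_conjTranspose]
  have mul_star : theta α * star (theta α) = 1 := by
    rw [star_eq, theta]
    ext i j : 1
    fin_cases i <;> fin_cases j <;>
      simp [Matrix.mul_apply, Fin.sum_univ_two, rhoL_mul_self hα, rhoR_mul_self hα,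
        rhoR_mul_eq_mul_rhoL hα, conjTranspose_mul_rhoR hα]
  have comp_star : star (thetaFull α) =
      Matrix.compRingEquiv (Fin 2) (Fin k) ℂ (star (theta α)) := by
    ext ⟨i, a⟩ ⟨j, b⟩
    rfl
  rw [Matrix.mem_unitaryGroup_iff, comp_star]
  exact (map_mul (Matrix.compRingEquiv (Fin 2) (Fin k) ℂ) _ _).symm.trans
    (by rw [mul_star, map_one])

end StrictContraction

variable {k : ℕ}

section InnerProduct

variable {μ : MatrixMeasure k} {f g h : Circle → Mat k}

lemma integrable_density (μ : MatrixMeasure k) (i j : Fin k) :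
    Integrable (fun z => μ.density z i j) μ.scalar := by
  refine Integrable.of_bound (μ.aemeasurable i j).aestronglyMeasurable 1 ?_
  filter_upwards [μ.posSemidef, μ.trace_eq_one] with z hpos htrace
  simpa only [htrace, RCLike.one_re] using norm_apply_le_trace_of_posSemidef hpos i j

lemma integrable_innerR (hf : Continuous f) (hg : Continuous g) (i j : Fin k) :
    Integrable (fun z => ((f z).conjTranspose * μ.density z * g z) i j) μ.scalar := by
  simp only [Matrix.mul_apply, Matrix.conjTranspose_apply, Finset.sum_mul,
    mul_right_comm _ _ (g _ _ _)]
  refine integrable_finsetSum _ fun a _ => integrable_finsetSum _ fun b _ => ?_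
  have hcont : Continuous fun z => star (f z b i) * g z a j :=
    (hf.matrix_elem b i).star.mul (hg.matrix_elem a j)
  obtain ⟨M, hM⟩ := isCompact_univ.exists_bound_of_continuousOn hcont.continuousOn
  exact (integrable_density μ b a).bdd_mul hcont.aestronglyMeasurable
    (Filter.Eventually.of_forall fun z => hM z trivial)

lemma conjTranspose_innerR (f g : Circle → Mat k) :
    (innerR μ f g).conjTranspose = innerR μ g f := by
  ext i j
  simp only [innerR, Matrix.of_apply, Matrix.conjTranspose_apply, RCLike.star_def]
  rw [← integral_conj]
  refine integral_congr_ae ?_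
  filter_upwards [μ.posSemidef] with z hz
  rw [← RCLike.star_def, ← Matrix.conjTranspose_apply, Matrix.conjTranspose_mul,
    Matrix.conjTranspose_mul, Matrix.conjTranspose_conjTranspose, hz.isHermitian.eq, mul_assoc]

lemma innerL_eq_innerR (f g : Circle → Mat k) :
    innerL μ f g = innerR μ (fun z => (g z).conjTranspose) (fun z => (f z).conjTranspose) := by
  simp only [innerL, innerR, Matrix.conjTranspose_conjTranspose]

lemma innerR_add_right (hf : Continuous f) (hg : Continuous g) (hh : Continuous h) :
    innerR μ f (fun z => g z + h z) = innerR μ f g + innerR μ f h := by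
  ext i j
  simp only [innerR, Matrix.of_apply, Matrix.add_apply, mul_add]
  exact integral_add (integrable_innerR hf hg i j) (integrable_innerR hf hh i j)

lemma innerR_mul_right (hf : Continuous f) (hg : Continuous g) (B : Mat k) :
    innerR μ f (fun z => g z * B) = innerR μ f g * B := by
  ext i j
  simp only [innerR, Matrix.of_apply, ← mul_assoc]
  simp only [Matrix.mul_apply (N := B), Matrix.of_apply]
  rw [integral_finsetSum _ fun a _ => (integrable_innerR hf hg i a).mul_const _]
  simp only [integral_mul_const]

lemma innerR_sum_right {ι : Type*} (s : Finset ι) {g : ι → Circle → Mat k} (hf : Continuous f)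
    (hg : ∀ i, Continuous (g i)) :
    innerR μ f (fun z => ∑ i ∈ s, g i z) = ∑ i ∈ s, innerR μ f (g i) := by
  classical
  induction s using Finset.induction_on with
  | empty => simpa using innerR_mul_right (μ := μ) hf hf 0
  | insert a s ha ih =>
    simp only [Finset.sum_insert ha]
    rw [innerR_add_right hf (hg a) (continuous_finsetSum _ fun i _ => hg i), ih]

lemma innerR_self_posSemidef (hf : Continuous f) : (innerR μ f f).PosSemidef := by
  refine Matrix.PosSemidef.of_dotProduct_mulVec_nonneg (conjTranspose_innerR f f) fun x => ?_
  have quadratic_form : star x ⬝ᵥ (innerR μ f f).mulVec x =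
      ∫ z, star x ⬝ᵥ (((f z).conjTranspose * μ.density z * f z).mulVec x) ∂μ.scalar := by
    simp only [dotProduct, Matrix.mulVec, innerR, Matrix.of_apply]
    rw [integral_finsetSum _ fun i _ => (integrable_finsetSum _ fun j _ =>
      (integrable_innerR hf hf i j).mul_const _).const_mul _]
    refine Finset.sum_congr rfl fun i _ => ?_
    rw [integral_const_mul, integral_finsetSum _ fun j _ =>
      (integrable_innerR hf hf i j).mul_const _]
    simp only [integral_mul_const]
  rw [quadratic_form]
  refine integral_nonneg_of_ae ?_
  filter_upwards [μ.posSemidef] with z hz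
  exact (hz.conjTranspose_mul_mul_same (f z)).dotProduct_mulVec_nonneg x

lemma star_circle_zpow (z : Circle) (n : ℤ) : star ((z : ℂ) ^ n) = (z : ℂ) ^ (-n) := by
  rw [RCLike.star_def, map_zpow₀, ← Circle.coe_inv_eq_conj, Circle.coe_inv, inv_zpow, zpow_neg]

lemma innerR_zpow_smul_of_sub_eq {a b c d : ℤ} (habcd : b - a = d - c) (f g : Circle → Mat k) :
    innerR μ (fun z => (z : ℂ) ^ a • f z) (fun z => (z : ℂ) ^ b • g z) =
      innerR μ (fun z => (z : ℂ) ^ c • f z) (fun z => (z : ℂ) ^ d • g z) := by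
  have cancel (m n : ℤ) (z : Circle) :
      ((z : ℂ) ^ m • f z).conjTranspose * μ.density z * ((z : ℂ) ^ n • g z) =
        (z : ℂ) ^ (n - m) • ((f z).conjTranspose * μ.density z * g z) := by
    rw [Matrix.conjTranspose_smul, star_circle_zpow, Matrix.smul_mul, Matrix.smul_mul,
      Matrix.mul_smul, smul_smul, ← zpow_add₀ (Circle.coe_ne_zero z), neg_add_eq_sub]
  simp only [innerR, cancel, habcd]

end InnerProduct

section Evaluation

/-- The evaluation of polynomials with matrix coefficients at a scalar `w`, which is
multiplicative because scalars commute with the coefficients. -/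
def evalHom (w : ℂ) : (Mat k)[X] →+* Mat k :=
  eval₂RingHom' (RingHom.id _) (algebraMap ℂ (Mat k) w) fun a => (Algebra.commutes w a).symm

lemma evalCircle_eq_evalHom (P : (Mat k)[X]) (z : Circle) : evalCircle P z = evalHom (z : ℂ) P := by
  change _ = P.eval₂ (RingHom.id _) (algebraMap ℂ (Mat k) z)
  rw [eval₂_eq_sum]
  refine Finset.sum_congr rfl fun j _ => ?_
  simp only [RingHom.id_apply]
  rw [← map_pow, ← Algebra.commutes, Algebra.smul_def]

lemma evalCircle_eq_sum {P : (Mat k)[X]} {n : ℕ} (hP : P.natDegree ≤ n) (z : Circle) :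
    evalCircle P z = ∑ j ∈ Finset.range (n + 1), (z : ℂ) ^ (j : ℤ) • P.coeff j := by
  simp only [zpow_natCast]
  exact sum_over_range' _ (by simp) _ (by omega)

/-- The matrix-valued Laurent polynomial `z ↦ z^c P(z)` on the circle. In particular
`laurent c 1` is the function `z ↦ z^c 1`. -/
def laurent (c : ℤ) (P : (Mat k)[X]) (z : Circle) : Mat k := (z : ℂ) ^ c • evalCircle P z

variable (c : ℤ) (P Q : (Mat k)[X]) (B : Mat k) (z : Circle)

lemma laurent_zero : laurent 0 P = evalCircle P := by
  funext z
  rw [laurent, zpow_zero, one_smul]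

lemma laurent_add : laurent c (P + Q) z = laurent c P z + laurent c Q z := by
  simp only [laurent, evalCircle_eq_evalHom, map_add, smul_add]

lemma laurent_mul_C : laurent c (P * C B) z = laurent c P z * B := by
  have evalHom_C : evalHom (z : ℂ) (C B) = B := eval₂_C _ _
  rw [laurent, laurent, evalCircle_eq_evalHom, evalCircle_eq_evalHom, map_mul, evalHom_C,
    Matrix.smul_mul]

lemma laurent_X_mul : laurent c (X * P) = laurent (c + 1) P := by
  funext z
  have evalHom_X : evalHom (z : ℂ) X = algebraMap ℂ (Mat k) z := eval₂_X _ _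
  rw [laurent, laurent, evalCircle_eq_evalHom, evalCircle_eq_evalHom, map_mul, evalHom_X,
    ← Algebra.smul_def, smul_smul, zpow_add_one₀ (Circle.coe_ne_zero z)]

lemma laurent_X_pow_mul (n : ℕ) : laurent c (X ^ n * P) = laurent (c + n) P := by
  induction n generalizing c with
  | zero => rw [pow_zero, one_mul, Nat.cast_zero, add_zero]
  | succ n ih => rw [pow_succ', mul_assoc, laurent_X_mul, ih, Nat.cast_succ, add_assoc, add_comm 1]

lemma laurent_C : laurent c (C B) z = (z : ℂ) ^ c • B := by
  rw [laurent, evalCircle_eq_evalHom]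
  exact congrArg _ (eval₂_C _ _)

@[fun_prop]
lemma continuous_laurent : Continuous (laurent c P) := by
  have : laurent c P = fun z : Circle => (z : ℂ) ^ c •
      ∑ j ∈ Finset.range (P.natDegree + 1), (z : ℂ) ^ (j : ℤ) • P.coeff j :=
    funext fun z => by rw [laurent, evalCircle_eq_sum le_rfl]
  have continuous_zpow (n : ℤ) : Continuous fun z : Circle => (z : ℂ) ^ n :=
    Continuous.zpow₀ (by fun_prop) n fun z => Or.inl (Circle.coe_ne_zero z)
  rw [this]
  exact (continuous_zpow c).smul
    (continuous_finsetSum _ fun j _ => (continuous_zpow j).smul continuous_const)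

end Evaluation

section SzegoDual

lemma coeff_szegoDual (n : ℕ) (P : (Mat k)[X]) (j : ℕ) :
    (szegoDual n P).coeff j = if j ≤ n then (P.coeff (n - j)).conjTranspose else 0 := by
  simp only [szegoDual, finsetSum_coeff, coeff_monomial, Finset.sum_ite_eq', Finset.mem_range,
    Nat.lt_succ_iff]

lemma natDegree_szegoDual_le (n : ℕ) (P : (Mat k)[X]) : (szegoDual n P).natDegree ≤ n :=
  natDegree_le_iff_coeff_eq_zero.2 fun j hj => by rw [coeff_szegoDual, if_neg (by omega)]

lemma szegoDual_szegoDual {n : ℕ} {P : (Mat k)[X]} (hP : P.natDegree ≤ n) :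
    szegoDual n (szegoDual n P) = P := by
  ext1 j
  rw [coeff_szegoDual]
  split_ifs with hj
  · rw [coeff_szegoDual, if_pos (by omega), Matrix.conjTranspose_conjTranspose,
      Nat.sub_sub_self hj]
  · rw [coeff_eq_zero_of_natDegree_lt (by omega)]

lemma szegoDual_add (n : ℕ) (P Q : (Mat k)[X]) :
    szegoDual n (P + Q) = szegoDual n P + szegoDual n Q := by
  ext1 j
  simp only [coeff_szegoDual, coeff_add]
  split_ifs <;> simp [Matrix.conjTranspose_add]

lemma szegoDual_mul_C (n : ℕ) (B : Mat k) (P : (Mat k)[X]) :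
    szegoDual n (P * C B) = C B.conjTranspose * szegoDual n P := by
  ext1 j
  simp only [coeff_szegoDual, coeff_C_mul, coeff_mul_C]
  split_ifs <;> simp [Matrix.conjTranspose_mul]

lemma szegoDual_succ_X_mul (n : ℕ) (P : (Mat k)[X]) :
    szegoDual (n + 1) (X * P) = szegoDual n P := by
  ext1 j
  simp only [coeff_szegoDual]
  split_ifs with h1 h2 h2
  · rw [show n + 1 - j = (n - j) + 1 by omega, coeff_X_mul]
  · rw [show n + 1 - j = 0 by omega, mul_coeff_zero, coeff_X_zero, zero_mul,
      Matrix.conjTranspose_zero]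
  · omega
  · rfl

lemma szegoDual_succ {n : ℕ} {P : (Mat k)[X]} (hP : P.natDegree ≤ n) :
    szegoDual (n + 1) P = X * szegoDual n P := by
  ext1 j
  rcases j with _ | j
  · rw [coeff_szegoDual, if_pos (Nat.zero_le _), mul_coeff_zero, coeff_X_zero, zero_mul,
      coeff_eq_zero_of_natDegree_lt (by omega), Matrix.conjTranspose_zero]
  · simp only [coeff_X_mul, coeff_szegoDual, Nat.add_sub_add_right, Nat.add_le_add_iff_right]

lemma conjTranspose_laurent {n : ℕ} {P : (Mat k)[X]} (hP : P.natDegree ≤ n) (c : ℤ) (z : Circle) :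
    (laurent c P z).conjTranspose = laurent (-c - n) (szegoDual n P) z := by
  have conjTranspose_evalCircle : (evalCircle P z).conjTranspose =
      (z : ℂ) ^ (-n : ℤ) • evalCircle (szegoDual n P) z := by
    rw [evalCircle_eq_sum (natDegree_szegoDual_le n P), evalCircle_eq_sum hP,
      ← Finset.sum_range_reflect, Matrix.conjTranspose_sum, Finset.smul_sum]
    refine Finset.sum_congr rfl fun j hj => ?_
    have hj' : j ≤ n := Nat.lt_succ_iff.1 (Finset.mem_range.1 hj)
    rw [coeff_szegoDual, if_pos (by omega), Matrix.conjTranspose_smul, star_circle_zpow, smul_smul,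
      ← zpow_add₀ (Circle.coe_ne_zero z)]
    congr 3
    all_goals omega
  rw [laurent, laurent, Matrix.conjTranspose_smul, star_circle_zpow, conjTranspose_evalCircle,
    smul_smul, ← zpow_add₀ (Circle.coe_ne_zero z), sub_eq_add_neg]

end SzegoDual

section InnerPoly

variable {μ : MatrixMeasure k}

/-- The inner product `⟨⟨P, Q⟩⟩_R` of two polynomials with matrix coefficients. -/
def innerPoly (μ : MatrixMeasure k) (P Q : (Mat k)[X]) : Mat k :=
  innerR μ (evalCircle P) (evalCircle Q)

lemma innerR_laurent_of_sub_eq {a b c d : ℤ} (h : b - a = d - c) (P Q : (Mat k)[X]) :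
    innerR μ (laurent a P) (laurent b Q) = innerR μ (laurent c P) (laurent d Q) :=
  innerR_zpow_smul_of_sub_eq h _ _

lemma innerR_laurent_laurent (c : ℤ) (P Q : (Mat k)[X]) :
    innerR μ (laurent c P) (laurent c Q) = innerPoly μ P Q := by
  rw [innerR_laurent_of_sub_eq (c := 0) (d := 0) (by omega), laurent_zero, laurent_zero, innerPoly]

lemma innerR_laurent_one_left {a c : ℤ} {j : ℕ} (h : a = c + j) (P : (Mat k)[X]) :
    innerR μ (laurent a 1) (laurent c P) = innerPoly μ (X ^ j) P := by
  rw [h, ← laurent_X_pow_mul, mul_one, innerR_laurent_laurent]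

lemma innerPoly_X_mul_X_mul (P Q : (Mat k)[X]) :
    innerPoly μ (X * P) (X * Q) = innerPoly μ P Q := by
  rw [← innerR_laurent_laurent 0, laurent_X_mul, laurent_X_mul, innerR_laurent_laurent]

lemma conjTranspose_innerPoly (P Q : (Mat k)[X]) :
    (innerPoly μ P Q).conjTranspose = innerPoly μ Q P := conjTranspose_innerR _ _

lemma innerPoly_add_right (P Q R : (Mat k)[X]) :
    innerPoly μ P (Q + R) = innerPoly μ P Q + innerPoly μ P R := by
  simp only [← innerR_laurent_laurent 0, funext (laurent_add 0 Q R)]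
  exact innerR_add_right (by fun_prop) (by fun_prop) (by fun_prop)

lemma innerPoly_mul_C_right (P Q : (Mat k)[X]) (B : Mat k) :
    innerPoly μ P (Q * C B) = innerPoly μ P Q * B := by
  simp only [← innerR_laurent_laurent 0, funext (laurent_mul_C 0 Q B)]
  exact innerR_mul_right (by fun_prop) (by fun_prop) B

lemma innerPoly_mul_C_left (P Q : (Mat k)[X]) (B : Mat k) :
    innerPoly μ (P * C B) Q = B.conjTranspose * innerPoly μ P Q := by
  rw [← conjTranspose_innerPoly, innerPoly_mul_C_right, Matrix.conjTranspose_mul,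
    conjTranspose_innerPoly]

lemma innerPoly_sub_right (P Q R : (Mat k)[X]) :
    innerPoly μ P (Q - R) = innerPoly μ P Q - innerPoly μ P R :=
  eq_sub_of_add_eq (by rw [← innerPoly_add_right, sub_add_cancel])

lemma innerPoly_eq_sum_right {s : Finset ℕ} {Q : (Mat k)[X]} (hQ : Q.support ⊆ s)
    (P : (Mat k)[X]) :
    innerPoly μ P Q = ∑ j ∈ s, innerPoly μ P (X ^ j) * Q.coeff j := by
  have Q_eq : Q = ∑ j ∈ s, X ^ j * C (Q.coeff j) := by
    simp only [X_pow_mul_C]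
    exact Q.as_sum_support_C_mul_X_pow.trans <| Finset.sum_subset hQ fun j _ hj => by
      rw [notMem_support_iff.1 hj, C_0, zero_mul]
  calc innerPoly μ P Q = AddMonoidHom.mk' _ (innerPoly_add_right P) Q := rfl
    _ = ∑ j ∈ s, innerPoly μ P (X ^ j * C (Q.coeff j)) := by
      rw [Q_eq, map_sum, ← Q_eq]
      rfl
    _ = ∑ j ∈ s, innerPoly μ P (X ^ j) * Q.coeff j := by simp only [innerPoly_mul_C_right]

lemma eq_zero_of_trace_innerPoly_self_eq_zero (hμ : μ.Nontrivial) {P : (Mat k)[X]}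
    (hP : (innerPoly μ P P).trace = 0) : P = 0 := by
  have evalCircle_eq : evalCircle P = fun z : Circle => ∑ l : Fin (P.natDegree + 1),
      (z : ℂ) ^ (l : ℕ) • P.coeff l := by
    ext1 z
    rw [evalCircle_eq_sum le_rfl, Finset.sum_range]
    simp only [zpow_natCast]
  rw [innerPoly, evalCircle_eq] at hP
  have coeff_eq_zero := hμ _ (fun l => P.coeff l) hP
  ext1 j
  by_cases hj : j < P.natDegree + 1
  · exact coeff_eq_zero ⟨j, hj⟩
  · rw [coeff_eq_zero_of_natDegree_lt (by omega), coeff_zero]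

lemma posDef_innerPoly_self (hμ : μ.Nontrivial) {P : (Mat k)[X]} {j : ℕ}
    (hj : IsUnit (P.coeff j)) : (innerPoly μ P P).PosDef := by
  have nonneg : 0 ≤ innerPoly μ P P := by
    rw [← innerR_laurent_laurent 0]
    exact (innerR_self_posSemidef (continuous_laurent 0 P)).nonneg
  rw [← Matrix.isStrictlyPositive_iff_posDef]
  refine IsUnit.isStrictlyPositive ?_ nonneg
  rw [Matrix.isUnit_iff_isUnit_det, isUnit_iff_ne_zero, Ne, ← Matrix.exists_mulVec_eq_zero_iff]
  rintro ⟨x, hx, hPx⟩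
  let B : Mat k := Matrix.of fun i _ => x i
  have innerPoly_mul_B : innerPoly μ P P * B = 0 := Matrix.ext fun i _ => congrFun hPx i
  have mul_C_B : P * C B = 0 := eq_zero_of_trace_innerPoly_self_eq_zero hμ <| by
    rw [innerPoly_mul_C_right, innerPoly_mul_C_left, mul_assoc, innerPoly_mul_B, mul_zero,
      Matrix.trace_zero]
  have B_eq_zero : B = 0 := hj.mul_right_eq_zero.1 (by rw [← coeff_mul_C, mul_C_B, coeff_zero])
  exact hx (funext fun i => congrFun₂ B_eq_zero i i)

end InnerPoly

section NormalizedResidual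

/-- `P` is a normalized residual of `z^i` modulo the monomials `z^j`, `j ∈ s`: it is a combination
of `z^i` and of these `z^j`, it is orthogonal to the `z^j`, and `⟨⟨P, P⟩⟩_R = 1`. Then `P` is
determined up to a unitary factor on the right. -/
structure IsNormalizedResidual (μ : MatrixMeasure k) (s : Finset ℕ) (i : ℕ) (P : (Mat k)[X]) :
    Prop where
  support_subset : P.support ⊆ insert i s
  orthogonal : ∀ j ∈ s, innerPoly μ (X ^ j) P = 0
  innerPoly_self : innerPoly μ P P = 1

/-- The part of `P` orthogonal to `Q`, normalized by the positive square root of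
`1 - ⟨⟨P, Q⟩⟩_R ⟨⟨Q, P⟩⟩_R`. One step of the Szegő recursion is of this form. -/
def normalizedResidual (μ : MatrixMeasure k) (P Q : (Mat k)[X]) : (Mat k)[X] :=
  (P - Q * C (innerPoly μ Q P)) * C (rhoR (innerPoly μ P Q))⁻¹

variable {μ : MatrixMeasure k} {s : Finset ℕ} {i a b : ℕ} {P Q : (Mat k)[X]}

namespace IsNormalizedResidual

lemma innerPoly_eq (hP : IsNormalizedResidual μ s i P)
    (hQ : ∀ j ∈ s, innerPoly μ (X ^ j) Q = 0) :
    innerPoly μ Q P = innerPoly μ Q (X ^ i) * P.coeff i := by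
  rw [innerPoly_eq_sum_right hP.support_subset]
  refine Finset.sum_eq_single_of_mem i (Finset.mem_insert_self i s) fun j hj hji => ?_
  rw [← conjTranspose_innerPoly, hQ j (Finset.mem_of_mem_insert_of_ne hj hji),
    Matrix.conjTranspose_zero, zero_mul]

lemma isUnit_coeff (hP : IsNormalizedResidual μ s i P) : IsUnit (P.coeff i) :=
  .of_mul_eq_one_right _ ((hP.innerPoly_eq hP.orthogonal).symm.trans hP.innerPoly_self)

lemma coeff_eq_zero (hP : IsNormalizedResidual μ s i P) (ha : a ∉ insert i s) : P.coeff a = 0 :=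
  notMem_support_iff.1 fun h => ha (hP.support_subset h)

lemma eq_mul_C (hμ : μ.Nontrivial) (hP : IsNormalizedResidual μ s i P)
    (hQ : IsNormalizedResidual μ s i Q) : Q = P * C ((P.coeff i)⁻¹ * Q.coeff i) := by
  set U := (P.coeff i)⁻¹ * Q.coeff i
  have hU : P.coeff i * U = Q.coeff i := Matrix.mul_nonsing_inv_cancel_left _ _
    ((Matrix.isUnit_iff_isUnit_det _).1 hP.isUnit_coeff)
  set R := Q - P * C U with hR
  have R_orthogonal (j) (hj : j ∈ s) : innerPoly μ (X ^ j) R = 0 := by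
    rw [hR, innerPoly_sub_right, innerPoly_mul_C_right, hQ.orthogonal j hj, hP.orthogonal j hj,
      zero_mul, sub_zero]
  have R_self : innerPoly μ R R = 0 := by
    nth_rw 2 [hR]
    rw [innerPoly_sub_right, innerPoly_mul_C_right, hP.innerPoly_eq R_orthogonal,
      hQ.innerPoly_eq R_orthogonal, mul_assoc, hU, sub_self]
  exact sub_eq_zero.1 (eq_zero_of_trace_innerPoly_self_eq_zero hμ
    (by rw [R_self, Matrix.trace_zero]))

lemma eq_of_posDef (hμ : μ.Nontrivial) (hP : IsNormalizedResidual μ s i P)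
    (hQ : IsNormalizedResidual μ s i Q) {A : Mat k} (hAP : (A * P.coeff i).PosDef)
    (hAQ : (A * Q.coeff i).PosDef) : P = Q := by
  have Q_eq := hP.eq_mul_C hμ hQ
  set U := (P.coeff i)⁻¹ * Q.coeff i
  have hU : U ∈ Matrix.unitaryGroup (Fin k) ℂ := by
    rw [Matrix.mem_unitaryGroup_iff', Matrix.star_eq_conjTranspose]
    calc U.conjTranspose * U = innerPoly μ (P * C U) (P * C U) := by
          rw [innerPoly_mul_C_left, innerPoly_mul_C_right, hP.innerPoly_self, one_mul]
      _ = 1 := by rw [← Q_eq, hQ.innerPoly_self]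
  have U_eq_one : U = 1 :=
    eq_one_of_posDef_mul hAP (by rwa [mul_assoc, ← coeff_mul_C, ← Q_eq]) hU
  rw [Q_eq, U_eq_one, C_1, mul_one]

lemma X_mul {c d : ℕ} (hP : IsNormalizedResidual μ (Finset.Ico c d) i P) :
    IsNormalizedResidual μ (Finset.Ico (c + 1) (d + 1)) (i + 1) (X * P) where
  support_subset j hj := by
    rcases j with _ | j
    · simp at hj
    · rw [mem_support_iff, coeff_X_mul, ← mem_support_iff] at hj
      simpa using hP.support_subset hj
  orthogonal j hj := by
    rw [Finset.mem_Ico] at hj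
    obtain ⟨j, rfl⟩ : ∃ l, j = l + 1 := ⟨j - 1, by omega⟩
    rw [pow_succ', innerPoly_X_mul_X_mul, hP.orthogonal j (Finset.mem_Ico.2 (by omega))]
  innerPoly_self := by rw [innerPoly_X_mul_X_mul, hP.innerPoly_self]

section Step

variable (hμ : μ.Nontrivial) (hP : IsNormalizedResidual μ s a P)
  (hQ : IsNormalizedResidual μ s b Q) (ha : a ∉ insert b s)

include hP hQ in
lemma innerPoly_sub_mul_C_self :
    innerPoly μ (P - Q * C (innerPoly μ Q P)) (P - Q * C (innerPoly μ Q P)) =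
      1 - innerPoly μ P Q * (innerPoly μ P Q).conjTranspose := by
  have orthogonal_Q : innerPoly μ (P - Q * C (innerPoly μ Q P)) Q = 0 := by
    rw [← conjTranspose_innerPoly, innerPoly_sub_right, innerPoly_mul_C_right, hQ.innerPoly_self,
      one_mul, sub_self, Matrix.conjTranspose_zero]
  rw [innerPoly_sub_right, innerPoly_mul_C_right, orthogonal_Q, zero_mul, sub_zero,
    ← conjTranspose_innerPoly, innerPoly_sub_right, innerPoly_mul_C_right, hP.innerPoly_self,
    Matrix.conjTranspose_sub, Matrix.conjTranspose_one, Matrix.conjTranspose_mul,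
    conjTranspose_innerPoly]

include hQ ha in
lemma coeff_normalizedResidual :
    (normalizedResidual μ P Q).coeff a = P.coeff a * (rhoR (innerPoly μ P Q))⁻¹ := by
  rw [normalizedResidual, coeff_mul_C, coeff_sub, coeff_mul_C, hQ.coeff_eq_zero ha, zero_mul,
    sub_zero]

include hμ hP hQ ha

lemma norm_innerPoly_lt_one :
    ‖Matrix.toEuclideanCLM (n := Fin k) (𝕜 := ℂ) (innerPoly μ P Q)‖ < 1 := by
  rw [← posDef_one_sub_mul_conjTranspose_self_iff, ← hP.innerPoly_sub_mul_C_self hQ]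
  refine posDef_innerPoly_self hμ (j := a) ?_
  rw [coeff_sub, coeff_mul_C, hQ.coeff_eq_zero ha, zero_mul, sub_zero]
  exact hP.isUnit_coeff

lemma posDef_inv_coeff_mul_coeff_normalizedResidual :
    ((P.coeff a)⁻¹ * (MatrixCMV.normalizedResidual μ P Q).coeff a).PosDef := by
  rw [coeff_normalizedResidual hQ ha, Matrix.nonsing_inv_mul_cancel_left _ _
    ((Matrix.isUnit_iff_isUnit_det _).1 hP.isUnit_coeff)]
  exact (posDef_rhoR (hP.norm_innerPoly_lt_one hμ hQ ha)).inv

lemma normalizedResidual_mul_add :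
    P = normalizedResidual μ P Q * C (rhoR (innerPoly μ P Q)) +
      Q * C (innerPoly μ P Q).conjTranspose := by
  have hρ := posDef_rhoR (hP.norm_innerPoly_lt_one hμ hQ ha)
  rw [normalizedResidual, mul_assoc, ← C_mul,
    Matrix.nonsing_inv_mul _ ((Matrix.isUnit_iff_isUnit_det _).1 hρ.isUnit), C_1, mul_one,
    conjTranspose_innerPoly, sub_add_cancel]

lemma normalizedResidual : IsNormalizedResidual μ (insert b s) a (normalizedResidual μ P Q) := by
  set W := P - Q * C (innerPoly μ Q P) with hW
  set ρ := rhoR (innerPoly μ P Q) with hρdef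
  have hρ : ρ.PosDef := posDef_rhoR (hP.norm_innerPoly_lt_one hμ hQ ha)
  have hρ_unit : IsUnit ρ.det := (Matrix.isUnit_iff_isUnit_det _).1 hρ.isUnit
  have W_orthogonal (j) (hj : j ∈ s) : innerPoly μ (X ^ j) W = 0 := by
    rw [hW, innerPoly_sub_right, innerPoly_mul_C_right, hP.orthogonal j hj, hQ.orthogonal j hj,
      zero_mul, sub_zero]
  have W_orthogonal_b : innerPoly μ W (X ^ b) = 0 := by
    refine hQ.isUnit_coeff.mul_left_eq_zero.1 ?_
    rw [← hQ.innerPoly_eq W_orthogonal, ← conjTranspose_innerPoly, hW, innerPoly_sub_right,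
      innerPoly_mul_C_right, hQ.innerPoly_self, one_mul, sub_self, Matrix.conjTranspose_zero]
  refine ⟨fun j hj => ?_, fun j hj => ?_, ?_⟩
  · by_contra hjs
    simp only [Finset.mem_insert, not_or] at hjs
    refine mem_support_iff.1 hj ?_
    rw [MatrixCMV.normalizedResidual, coeff_mul_C, coeff_sub, coeff_mul_C,
      hP.coeff_eq_zero (by simp [hjs]), hQ.coeff_eq_zero (by simp [hjs]), zero_mul, sub_zero,
      zero_mul]
  · rw [MatrixCMV.normalizedResidual, innerPoly_mul_C_right]
    rcases Finset.mem_insert.1 hj with rfl | hj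
    · rw [← conjTranspose_innerPoly, W_orthogonal_b, Matrix.conjTranspose_zero, zero_mul]
    · rw [W_orthogonal j hj, zero_mul]
  · rw [MatrixCMV.normalizedResidual, innerPoly_mul_C_left, innerPoly_mul_C_right,
      hP.innerPoly_sub_mul_C_self hQ,
      ← rhoR_mul_self (hP.norm_innerPoly_lt_one hμ hQ ha), ← hρdef, hρ.isHermitian.inv.eq,
      Matrix.mul_nonsing_inv_cancel_right _ _ hρ_unit, Matrix.nonsing_inv_mul _ hρ_unit]

end Step

end IsNormalizedResidual

end NormalizedResidual

section SzegoRecursion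

/-- The pairs `(φ^R_n, (φ^L_n)^*)`, generated from `(1, 1)` by the Szegő recursion: each entry of
the next pair is the normalized residual of one of `z φ^R_n`, `(φ^L_n)^*` against the other. -/
def szegoPair (μ : MatrixMeasure k) : ℕ → (Mat k)[X] × (Mat k)[X]
  | 0 => (1, 1)
  | n + 1 =>
    (normalizedResidual μ (X * (szegoPair μ n).1) (szegoPair μ n).2,
      normalizedResidual μ (szegoPair μ n).2 (X * (szegoPair μ n).1))

lemma innerPoly_one_one (μ : MatrixMeasure k) : innerPoly μ 1 1 = 1 := by
  ext i j
  simp only [innerPoly, innerR, evalCircle_eq_evalHom, map_one, Matrix.conjTranspose_one, one_mul,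
    mul_one, Matrix.of_apply, μ.normalized]

lemma isNormalizedResidual_szegoPair {μ : MatrixMeasure k} (hμ : μ.Nontrivial) (n : ℕ) :
    IsNormalizedResidual μ (Finset.Ico 0 n) n (szegoPair μ n).1 ∧
      IsNormalizedResidual μ (Finset.Ico 1 (n + 1)) 0 (szegoPair μ n).2 := by
  induction n with
  | zero =>
    have support_one : (1 : (Mat k)[X]).support ⊆ {0} := support_C_subset 1
    exact ⟨⟨support_one, by simp, innerPoly_one_one μ⟩, ⟨support_one, by simp, innerPoly_one_one μ⟩⟩
  | succ n ih =>
    obtain ⟨hf, hg⟩ := ih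
    have insert_zero : insert 0 (Finset.Ico 1 (n + 1)) = Finset.Ico 0 (n + 1) := by
      ext j; simp only [Finset.mem_insert, Finset.mem_Ico]; omega
    have insert_succ : insert (n + 1) (Finset.Ico 1 (n + 1)) = Finset.Ico 1 (n + 2) := by
      ext j; simp only [Finset.mem_insert, Finset.mem_Ico]; omega
    exact ⟨insert_zero ▸ hf.X_mul.normalizedResidual hμ hg (by simp),
      insert_succ ▸ hg.normalizedResidual hμ hf.X_mul (by simp)⟩

end SzegoRecursion

section GramSchmidt

variable {μ : MatrixMeasure k} {e : ℕ → ℤ} {n : ℕ} {f : Circle → Mat k}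

lemma inModuleSpan_iff :
    InModuleSpan e n f ↔
      ∃ B : Fin n → Mat k, f = fun z => ∑ j : Fin n, laurent (e j) 1 z * B j := by
  simp only [InModuleSpan, ← laurent_mul_C, one_mul, laurent_C, funext_iff]

lemma inModuleSpan_laurent {c : ℤ} {P : (Mat k)[X]} (he : e.Injective) (hP : P.natDegree ≤ n)
    (hc : ∀ j ≤ n, c ≤ e j ∧ e j ≤ c + n) : InModuleSpan e (n + 1) (laurent c P) := by
  have bounds (j : Fin (n + 1)) := hc j (Nat.lt_succ_iff.1 j.2)
  let shift (j : Fin (n + 1)) : Fin (n + 1) := ⟨(e j - c).toNat, by have := bounds j; omega⟩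
  have add_shift (j) : c + (shift j : ℕ) = e j := by
    have := bounds j; simp only [shift]; omega
  have shift_bijective : shift.Bijective := Finite.injective_iff_bijective.1 fun i j hij =>
    Fin.ext (he (by rw [← add_shift, ← add_shift, hij]))
  refine ⟨fun j => P.coeff (shift j), fun z => ?_⟩
  calc laurent c P z = ∑ i : Fin (n + 1), (z : ℂ) ^ (c + (i : ℕ)) • P.coeff i := by
        rw [laurent, evalCircle_eq_sum hP, Finset.sum_range, Finset.smul_sum]
        simp only [smul_smul, ← zpow_add₀ (Circle.coe_ne_zero z)]
    _ = ∑ j : Fin (n + 1), (z : ℂ) ^ e j • P.coeff (shift j) := by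
        rw [← shift_bijective.sum_comp]
        simp only [add_shift]

lemma InModuleSpan.continuous (hf : InModuleSpan e n f) : Continuous f := by
  obtain ⟨B, rfl⟩ := inModuleSpan_iff.1 hf
  fun_prop

lemma InModuleSpan.exists_innerR_eq_sum (μ : MatrixMeasure k) (hf : InModuleSpan e n f) :
    ∃ B : Fin n → Mat k, ∀ g, Continuous g →
      innerR μ g f = ∑ j : Fin n, innerR μ g (laurent (e j) 1) * B j := by
  obtain ⟨B, rfl⟩ := inModuleSpan_iff.1 hf
  refine ⟨B, fun g hg => ?_⟩
  rw [innerR_sum_right _ hg fun j => by fun_prop]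
  exact Finset.sum_congr rfl fun j _ => innerR_mul_right hg (by fun_prop) _

/-- `F` arises, up to unitary factors, by orthonormalizing `z^{e_0}, z^{e_1}, …` in this order with
respect to `⟨⟨·, ·⟩⟩_R`. -/
structure IsGramSchmidtSeq (μ : MatrixMeasure k) (e : ℕ → ℤ) (F : ℕ → Circle → Mat k) : Prop where
  inModuleSpan : ∀ n, InModuleSpan e (n + 1) (F n)
  orthogonal : ∀ n, ∀ j < n, innerR μ (laurent (e j) 1) (F n) = 0
  innerR_self : ∀ n, innerR μ (F n) (F n) = 1

namespace IsGramSchmidtSeq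

variable {F : ℕ → Circle → Mat k}

lemma innerR_eq (hF : IsGramSchmidtSeq μ e F) (m n : ℕ) :
    innerR μ (F m) (F n) = if m = n then 1 else 0 := by
  have eq_zero_of_lt {m n : ℕ} (hmn : m < n) : innerR μ (F n) (F m) = 0 := by
    obtain ⟨B, hB⟩ := (hF.inModuleSpan m).exists_innerR_eq_sum μ
    rw [hB _ (hF.inModuleSpan n).continuous]
    refine Finset.sum_eq_zero fun j _ => ?_
    rw [← conjTranspose_innerR, hF.orthogonal n j (by omega), Matrix.conjTranspose_zero, zero_mul]
  rcases lt_trichotomy m n with h | rfl | h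
  · rw [← conjTranspose_innerR, eq_zero_of_lt h, Matrix.conjTranspose_zero, if_neg h.ne]
  · rw [hF.innerR_self, if_pos rfl]
  · rw [eq_zero_of_lt h, if_neg h.ne']

lemma of_orthonormal (hspan : ∀ n, InModuleSpan e (n + 1) (F n))
    (hF : ∀ m n, innerR μ (F m) (F n) = if m = n then 1 else 0) : IsGramSchmidtSeq μ e F := by
  have orthogonal_monomial (n : ℕ) : ∀ g, Continuous g → (∀ j ≤ n, innerR μ g (F j) = 0) →
      innerR μ g (laurent (e n) 1) = 0 := by
    induction n using Nat.strong_induction_on with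
    | _ n ih =>
      obtain ⟨B, hB⟩ := (hspan n).exists_innerR_eq_sum μ
      have last_term (g) (hg : Continuous g) (hgF : ∀ j < n, innerR μ g (F j) = 0) :
          innerR μ g (F n) = innerR μ g (laurent (e n) 1) * B (Fin.last n) := by
        rw [hB g hg, Fin.sum_univ_castSucc, Finset.sum_eq_zero fun j _ => ?_, zero_add,
          Fin.val_last]
        rw [Fin.val_castSucc, ih j j.2 g hg fun i hi => hgF i (by omega), zero_mul]
      have isUnit_last : IsUnit (B (Fin.last n)) := .of_mul_eq_one_right _ <|
        (last_term (F n) (hspan n).continuous fun j hj => by rw [hF, if_neg hj.ne']).symm.trans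
          (by rw [hF, if_pos rfl])
      intro g hg hgF
      exact isUnit_last.mul_left_eq_zero.1 <|
        (last_term g hg fun j hj => hgF j hj.le).symm.trans (hgF n le_rfl)
  refine ⟨hspan, fun n j hj => ?_, fun n => by rw [hF, if_pos rfl]⟩
  rw [← conjTranspose_innerR, orthogonal_monomial j (F n) (hspan n).continuous fun i hi => by
    rw [hF, if_neg (by omega)], Matrix.conjTranspose_zero]

end IsGramSchmidtSeq

end GramSchmidt

section OrthogonalPolynomials

variable {μ : MatrixMeasure k} {φL φR : ℕ → (Mat k)[X]}

namespace IsNormalizedResidual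

variable {s : Finset ℕ} {i n : ℕ} {P : (Mat k)[X]}

lemma natDegree_le (hP : IsNormalizedResidual μ s i P) (hs : ∀ j ∈ insert i s, j ≤ n) :
    P.natDegree ≤ n :=
  natDegree_le_iff_coeff_eq_zero.2 fun j hj => hP.coeff_eq_zero fun hjs => (hs j hjs).not_gt hj

lemma innerR_laurent_eq_zero (hP : IsNormalizedResidual μ s i P) {a c : ℤ} (hca : c ≤ a)
    (hs : (a - c).toNat ∈ s) : innerR μ (laurent a 1) (laurent c P) = 0 := by
  rw [innerR_laurent_one_left (j := (a - c).toNat) (by omega), hP.orthogonal _ hs]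

end IsNormalizedResidual

/-- A sequence of normalized residuals whose leading coefficients `κ_n`, those of `z^{i_n}`, are
fixed by `κ_0 = 1` and `κ_n⁻¹ κ_{n+1} > 0`. The `φ^R_n` and the `(φ^L_n)^*` are of this form. -/
structure IsNormalizedResidualSeq (μ : MatrixMeasure k) (s : ℕ → Finset ℕ) (i : ℕ → ℕ)
    (P : ℕ → (Mat k)[X]) : Prop where
  isNormalizedResidual : ∀ n, IsNormalizedResidual μ (s n) (i n) (P n)
  leading_zero : (P 0).coeff (i 0) = 1
  leading_succ : ∀ n, (((P n).coeff (i n))⁻¹ * (P (n + 1)).coeff (i (n + 1))).PosDef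

lemma IsNormalizedResidualSeq.unique {s : ℕ → Finset ℕ} {i : ℕ → ℕ} {P Q : ℕ → (Mat k)[X]}
    (hμ : μ.Nontrivial) (hP : IsNormalizedResidualSeq μ s i P)
    (hQ : IsNormalizedResidualSeq μ s i Q) : P = Q := by
  ext1 n
  induction n with
  | zero =>
    refine (hP.isNormalizedResidual 0).eq_of_posDef hμ (hQ.isNormalizedResidual 0) (A := 1) ?_ ?_
    · simpa only [hP.leading_zero, one_mul] using Matrix.PosDef.one
    · simpa only [hQ.leading_zero, one_mul] using Matrix.PosDef.one
  | succ n ih =>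
    exact (hP.isNormalizedResidual (n + 1)).eq_of_posDef hμ (hQ.isNormalizedResidual (n + 1))
      (hP.leading_succ n) (ih ▸ hQ.leading_succ n)

lemma isRightOPUC_iff :
    IsRightOPUC μ φR ↔ IsNormalizedResidualSeq μ (fun n => Finset.Ico 0 n) id φR := by
  have inModuleSpan (h : ∀ n, (φR n).natDegree ≤ n) (n : ℕ) :
      InModuleSpan (fun j => (j : ℤ)) (n + 1) (evalCircle (φR n)) :=
    laurent_zero (φR n) ▸ inModuleSpan_laurent Nat.cast_injective (h n) (by omega)
  constructor <;> intro h
  · have hF := IsGramSchmidtSeq.of_orthonormal (inModuleSpan h.natDegree_le) h.orthonormal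
    refine ⟨fun n => ⟨fun j hj => ?_, fun j hj => ?_, hF.innerR_self n⟩, h.leading_zero,
      h.leading_succ⟩
    · have := le_natDegree_of_mem_supp j hj
      have := h.natDegree_le n
      simp only [Finset.mem_insert, Finset.mem_Ico, id]
      omega
    · rw [← innerR_laurent_one_left (zero_add (j : ℤ)).symm, laurent_zero]
      exact hF.orthogonal n j (Finset.mem_Ico.1 hj).2
  · have natDegree_le (n : ℕ) : (φR n).natDegree ≤ n :=
      (h.isNormalizedResidual n).natDegree_le (by simp; omega)
    have hF : IsGramSchmidtSeq μ (fun j => (j : ℤ)) fun n => evalCircle (φR n) :=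
      ⟨inModuleSpan natDegree_le, fun n j hj => laurent_zero (φR n) ▸
        (h.isNormalizedResidual n).innerR_laurent_eq_zero (by omega) (by simpa using hj),
        fun n => (h.isNormalizedResidual n).innerPoly_self⟩
    exact ⟨natDegree_le, hF.innerR_eq, h.leading_zero, h.leading_succ⟩

lemma coeff_zero_szegoDual (n : ℕ) (P : (Mat k)[X]) :
    (szegoDual n P).coeff 0 = (P.coeff n).conjTranspose := by
  rw [coeff_szegoDual, if_pos n.zero_le, Nat.sub_zero]

lemma posDef_coeff_mul_inv_iff_szegoDual (φ : ℕ → (Mat k)[X]) (n : ℕ) :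
    ((φ (n + 1)).coeff (n + 1) * ((φ n).coeff n)⁻¹).PosDef ↔
      (((szegoDual n (φ n)).coeff 0)⁻¹ * (szegoDual (n + 1) (φ (n + 1))).coeff 0).PosDef := by
  rw [coeff_zero_szegoDual, coeff_zero_szegoDual, ← Matrix.conjTranspose_nonsing_inv,
    ← Matrix.conjTranspose_mul, Matrix.posDef_conjTranspose_iff]

lemma isLeftOPUC_iff (hφ : ∀ n, (φL n).natDegree ≤ n) :
    IsLeftOPUC μ φL ↔ IsNormalizedResidualSeq μ (fun n => Finset.Ico 1 (n + 1)) 0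
        fun n => szegoDual n (φL n) := by
  have inModuleSpan (n : ℕ) : InModuleSpan (fun j => -(j : ℤ)) (n + 1)
      (laurent (-n) (szegoDual n (φL n))) :=
    inModuleSpan_laurent (fun i j => by simp) (natDegree_szegoDual_le n _) (by omega)
  have innerL_eq (m n : ℕ) : innerL μ (evalCircle (φL m)) (evalCircle (φL n)) =
      innerR μ (laurent (-n) (szegoDual n (φL n))) (laurent (-m) (szegoDual m (φL m))) := by
    rw [innerL_eq_innerR]
    simp only [← laurent_zero, conjTranspose_laurent (hφ _), neg_zero, zero_sub]
  constructor <;> intro h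
  · have hF := IsGramSchmidtSeq.of_orthonormal inModuleSpan fun m n => by
      rw [← innerL_eq, h.orthonormal]
      simp only [eq_comm]
    refine ⟨fun n => ⟨fun j hj => ?_, fun j hj => ?_, ?_⟩, ?_, fun n =>
      (posDef_coeff_mul_inv_iff_szegoDual φL n).1 (h.leading_succ n)⟩
    · have := (le_natDegree_of_mem_supp j hj).trans (natDegree_szegoDual_le n (φL n))
      simp only [Finset.mem_insert, Finset.mem_Ico, Pi.zero_apply]
      omega
    · rw [Finset.mem_Ico] at hj
      rw [← innerR_laurent_one_left (show -((n - j : ℕ) : ℤ) = -n + j by omega)]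
      exact hF.orthogonal n (n - j) (by omega)
    · rw [← innerR_laurent_laurent (-n), hF.innerR_self]
    · rw [Pi.zero_apply, coeff_zero_szegoDual, h.leading_zero, Matrix.conjTranspose_one]
  · have hF : IsGramSchmidtSeq μ (fun j => -(j : ℤ)) fun n =>
        laurent (-n) (szegoDual n (φL n)) :=
      ⟨inModuleSpan, fun n j hj => (h.isNormalizedResidual n).innerR_laurent_eq_zero (by omega)
          (by rw [Finset.mem_Ico]; omega),
        fun n => by rw [innerR_laurent_laurent, (h.isNormalizedResidual n).innerPoly_self]⟩
    refine ⟨hφ, fun m n => ?_, ?_, fun n =>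
      (posDef_coeff_mul_inv_iff_szegoDual φL n).2 (h.leading_succ n)⟩
    · rw [innerL_eq, hF.innerR_eq]
      simp only [eq_comm]
    · rw [← Matrix.conjTranspose_eq_one, ← coeff_zero_szegoDual]
      exact h.leading_zero

lemma IsLeftOPUC.unique {ψ : ℕ → (Mat k)[X]} (hμ : μ.Nontrivial) (hφ : IsLeftOPUC μ φL)
    (hψ : IsLeftOPUC μ ψ) : φL = ψ := by
  have szegoDual_eq := ((isLeftOPUC_iff hφ.natDegree_le).1 hφ).unique hμ
    ((isLeftOPUC_iff hψ.natDegree_le).1 hψ)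
  ext1 n
  rw [← szegoDual_szegoDual (hφ.natDegree_le n), congrFun szegoDual_eq n,
    szegoDual_szegoDual (hψ.natDegree_le n)]

lemma IsRightOPUC.unique {ψ : ℕ → (Mat k)[X]} (hμ : μ.Nontrivial) (hφ : IsRightOPUC μ φR)
    (hψ : IsRightOPUC μ ψ) : φR = ψ :=
  (isRightOPUC_iff.1 hφ).unique hμ (isRightOPUC_iff.1 hψ)

end OrthogonalPolynomials

section Verblunsky

variable {μ : MatrixMeasure k} {φL φR : ℕ → (Mat k)[X]} {α : ℕ → Mat k}

lemma isNormalizedResidualSeq_szegoPair (hμ : μ.Nontrivial) :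
    IsNormalizedResidualSeq μ (fun n => Finset.Ico 0 n) id (fun n => (szegoPair μ n).1) ∧
      IsNormalizedResidualSeq μ (fun n => Finset.Ico 1 (n + 1)) 0 fun n => (szegoPair μ n).2 := by
  have pair := isNormalizedResidual_szegoPair hμ
  refine ⟨⟨fun n => (pair n).1, coeff_one_zero, fun n => ?_⟩,
    ⟨fun n => (pair n).2, coeff_one_zero, fun n => ?_⟩⟩
  · simpa only [id, szegoPair, coeff_X_mul] using
      (pair n).1.X_mul.posDef_inv_coeff_mul_coeff_normalizedResidual hμ (pair n).2 (by simp)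
  · exact (pair n).2.posDef_inv_coeff_mul_coeff_normalizedResidual hμ (pair n).1.X_mul (by simp)

lemma IsVerblunsky.of_right_of_left_dual (hφL : ∀ n, (φL n).natDegree ≤ n)
    (norm_lt_one : ∀ n, ‖Matrix.toEuclideanCLM (n := Fin k) (𝕜 := ℂ) (α n)‖ < 1)
    (right : ∀ n, X * φR n =
      φR (n + 1) * C (rhoR (α n)) + szegoDual n (φL n) * C (α n).conjTranspose)
    (left_dual : ∀ n, szegoDual n (φL n) =
      szegoDual (n + 1) (φL (n + 1)) * C (rhoL (α n)) + X * φR n * C (α n)) :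
    IsVerblunsky φL φR α where
  norm_lt_one := norm_lt_one
  right := right
  left_dual := left_dual
  left n := by
    calc X * φL n = szegoDual (n + 1) (szegoDual n (φL n)) := by
          rw [szegoDual_succ (natDegree_szegoDual_le n _), szegoDual_szegoDual (hφL n)]
      _ = _ := by
          rw [left_dual, szegoDual_add, szegoDual_mul_C, szegoDual_mul_C, szegoDual_succ_X_mul,
            szegoDual_szegoDual (hφL (n + 1)), (posDef_rhoL (norm_lt_one n)).isHermitian.eq]
  right_dual n := by
    calc szegoDual n (φR n) = szegoDual (n + 1) (X * φR n) := (szegoDual_succ_X_mul n _).symm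
      _ = _ := by
          rw [right, szegoDual_add, szegoDual_mul_C, szegoDual_mul_C,
            szegoDual_succ (natDegree_szegoDual_le n _), szegoDual_szegoDual (hφL n),
            (posDef_rhoR (norm_lt_one n)).isHermitian.eq, Matrix.conjTranspose_conjTranspose]

lemma exists_isVerblunsky (hμ : μ.Nontrivial) :
    ∃ φL φR α, IsLeftOPUC μ φL ∧ IsRightOPUC μ φR ∧ IsVerblunsky φL φR α := by
  obtain ⟨hf, hg⟩ := isNormalizedResidualSeq_szegoPair hμ
  set f := fun n => (szegoPair μ n).1
  set g := fun n => (szegoPair μ n).2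
  have natDegree_g (n : ℕ) : (g n).natDegree ≤ n :=
    (hg.isNormalizedResidual n).natDegree_le (by simp)
  have hR : IsRightOPUC μ f := isRightOPUC_iff.2 hf
  have natDegree_dual (n : ℕ) : (szegoDual n (g n)).natDegree ≤ n := natDegree_szegoDual_le n _
  have dual_dual (n : ℕ) : szegoDual n (szegoDual n (g n)) = g n :=
    szegoDual_szegoDual (natDegree_g n)
  have hXf (n : ℕ) := (hf.isNormalizedResidual n).X_mul
  refine ⟨fun n => szegoDual n (g n), f, fun n => innerPoly μ (X * f n) (g n),
    (isLeftOPUC_iff natDegree_dual).2 (by simpa only [dual_dual] using hg), hR,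
    .of_right_of_left_dual natDegree_dual (fun n => ?_) (fun n => ?_) fun n => ?_⟩
  · exact (hXf n).norm_innerPoly_lt_one hμ (hg.isNormalizedResidual n) (by simp)
  · rw [dual_dual]
    exact (hXf n).normalizedResidual_mul_add hμ (hg.isNormalizedResidual n) (by simp)
  · have g_eq := (hg.isNormalizedResidual n).normalizedResidual_mul_add hμ (hXf n) (by simp)
    rw [conjTranspose_innerPoly, ← conjTranspose_innerPoly (X * f n), rhoR_conjTranspose] at g_eq
    rw [dual_dual, dual_dual]
    exact g_eq

lemma IsVerblunsky.eq_innerPoly (hL : IsLeftOPUC μ φL) (hR : IsRightOPUC μ φR)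
    (hV : IsVerblunsky φL φR α) (n : ℕ) :
    α n = innerPoly μ (X * φR n) (szegoDual n (φL n)) := by
  have hf := ((isRightOPUC_iff.1 hR).isNormalizedResidual n).X_mul
  have hg := ((isLeftOPUC_iff hL.natDegree_le).1 hL).isNormalizedResidual (n + 1)
  have orthogonal : innerPoly μ (X * φR n) (szegoDual (n + 1) (φL (n + 1))) = 0 := by
    rw [← conjTranspose_innerPoly, hf.innerPoly_eq fun j hj =>
        hg.orthogonal j (Finset.Ico_subset_Ico_right (Nat.le_succ _) hj),
      ← conjTranspose_innerPoly, hg.orthogonal _ (by simp), Matrix.conjTranspose_zero, zero_mul,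
      Matrix.conjTranspose_zero]
  rw [hV.left_dual, innerPoly_add_right, innerPoly_mul_C_right, innerPoly_mul_C_right, orthogonal,
    hf.innerPoly_self, zero_mul, zero_add, one_mul]

lemma IsVerblunsky.unique (hL : IsLeftOPUC μ φL) (hR : IsRightOPUC μ φR) {β : ℕ → Mat k}
    (hα : IsVerblunsky φL φR α) (hβ : IsVerblunsky φL φR β) : α = β :=
  funext fun n => (hα.eq_innerPoly hL hR n).trans (hβ.eq_innerPoly hL hR n).symm

lemma IsVerblunsky.szegoDual_succ_eq (hV : IsVerblunsky φL φR α) (n : ℕ) :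
    szegoDual (n + 1) (φL (n + 1)) =
      szegoDual n (φL n) * C (rhoL (α n)) - φR (n + 1) * C (α n) := by
  have hα := hV.norm_lt_one n
  refine ((posDef_rhoL hα).isUnit.map C).mul_left_injective ?_
  calc szegoDual (n + 1) (φL (n + 1)) * C (rhoL (α n))
      = szegoDual n (φL n) - X * φR n * C (α n) := eq_sub_of_add_eq (hV.left_dual n).symm
    _ = szegoDual n (φL n) * C (1 - (α n).conjTranspose * α n) -
          φR (n + 1) * C (rhoR (α n) * α n) := by
        rw [hV.right, C_sub, C_1, C_mul, C_mul, mul_sub, mul_one, add_mul, mul_assoc, mul_assoc]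
        abel
    _ = (szegoDual n (φL n) * C (rhoL (α n)) - φR (n + 1) * C (α n)) * C (rhoL (α n)) := by
        rw [← rhoL_mul_self hα, rhoR_mul_eq_mul_rhoL hα, C_mul, C_mul, sub_mul, mul_assoc,
          mul_assoc]

end Verblunsky

section Expansion

variable {μ : MatrixMeasure k} {u v y : ℕ → Circle → Mat k} {T : Matrix ℕ ℕ (Mat k)}

/-- `y_l = ∑_m u_m T_{ml}` for every `l`, where column `l` of `T` has only finitely many nonzero
entries: `T` holds the right-module coordinates of the `y_l` with respect to the `u_m`. -/
def IsExpansion (u y : ℕ → Circle → Mat k) (T : Matrix ℕ ℕ (Mat k)) : Prop :=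
  ∀ l, ∃ s : Finset ℕ, (∀ m ∉ s, T m l = 0) ∧ ∀ z, y l z = ∑ m ∈ s, u m z * T m l

namespace IsExpansion

lemma mulZ (h : IsExpansion u y T) :
    IsExpansion (fun l => mulZ (u l)) (fun l => mulZ (y l)) T := by
  intro l
  obtain ⟨s, hs, hy⟩ := h l
  refine ⟨s, hs, fun z => ?_⟩
  simp only [MatrixCMV.mulZ, hy, Finset.smul_sum, Matrix.smul_mul]

lemma innerR_eq_sum (h : IsExpansion u y T) (hu : ∀ m, Continuous (u m))
    {f : Circle → Mat k} (hf : Continuous f) (l : ℕ) :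
    ∃ s : Finset ℕ, (∀ m ∉ s, T m l = 0) ∧
      innerR μ f (y l) = ∑ m ∈ s, innerR μ f (u m) * T m l := by
  obtain ⟨s, hs, hy⟩ := h l
  refine ⟨s, hs, ?_⟩
  rw [funext hy, innerR_sum_right (g := fun m z => u m z * T m l) s hf
    fun m => (hu m).mul continuous_const]
  exact Finset.sum_congr rfl fun m _ => innerR_mul_right hf (hu m) _

lemma gramR_eq (h : IsExpansion u y T) (hu : ∀ m, Continuous (u m))
    (ho : ∀ l m, innerR μ (u l) (u m) = if l = m then 1 else 0) : gramR μ u y = T := by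
  ext j l : 1
  obtain ⟨s, hs, hy⟩ := h.innerR_eq_sum (μ := μ) hu (hu j) l
  rw [gramR, Matrix.of_apply, hy]
  simp only [ho, ite_mul, one_mul, zero_mul, Finset.sum_ite_eq]
  split_ifs with hj
  · rfl
  · exact (hs j hj).symm

lemma isBlockProduct (h : IsExpansion u y T) (hu : ∀ m, Continuous (u m))
    (hv : ∀ m, Continuous (v m)) : IsBlockProduct (gramR μ v y) (gramR μ v u) T := by
  intro j l
  obtain ⟨s, hs, hy⟩ := h.innerR_eq_sum (μ := μ) hu (hv j) l
  have support_subset : (Function.support fun m => gramR μ v u j m * T m l) ⊆ s := by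
    intro m hm
    by_contra hms
    exact hm (by simp only [hs m hms, mul_zero])
  exact ⟨s.finite_toSet.subset support_subset,
    hy.trans (finsum_eq_sum_of_support_subset _ support_subset).symm⟩

end IsExpansion

lemma directSum_apply (T : ℕ → Matrix (Fin 2) (Fin 2) (Mat k)) (p q : ℕ) (a b : Fin 2) :
    directSum T (2 * p + a) (2 * q + b) = if p = q then T p a b else 0 := by
  have div_two (p : ℕ) (a : Fin 2) : (2 * p + a) / 2 = p := by omega
  have ofNat_two (p : ℕ) (a : Fin 2) : Fin.ofNat 2 (2 * p + a) = a :=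
    Fin.ext (by simp only [Fin.ofNat]; omega)
  rw [directSum, Matrix.of_apply, div_two, div_two, ofNat_two, ofNat_two]

lemma exists_eq_two_mul_add_fin (l : ℕ) : ∃ (i : ℕ) (b : Fin 2), l = 2 * i + b :=
  ⟨l / 2, ⟨l % 2, Nat.mod_lt _ two_pos⟩, (Nat.div_add_mod l 2).symm⟩

lemma isExpansion_directSum {T : ℕ → Matrix (Fin 2) (Fin 2) (Mat k)}
    (h : ∀ i (b : Fin 2) z, y (2 * i + b) z =
      u (2 * i) z * T i 0 b + u (2 * i + 1) z * T i 1 b) : IsExpansion u y (directSum T) := by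
  intro l
  obtain ⟨i, b, rfl⟩ := exists_eq_two_mul_add_fin l
  refine ⟨{2 * i, 2 * i + 1}, fun m hm => ?_, fun z => ?_⟩
  · obtain ⟨p, a, rfl⟩ := exists_eq_two_mul_add_fin m
    rw [directSum_apply, if_neg]
    rintro rfl
    simp only [Finset.mem_insert, Finset.mem_singleton] at hm
    omega
  · have apply_zero := directSum_apply T i i 0 b
    have apply_one := directSum_apply T i i 1 b
    rw [if_pos rfl] at apply_zero apply_one
    rw [Finset.sum_pair (by omega), h, ← apply_zero, ← apply_one]
    rfl

lemma IsExpansion.oneDirectSum (h0 : y 0 = u 0)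
    (h : IsExpansion (fun l => u (l + 1)) (fun l => y (l + 1)) T) :
    IsExpansion u y (oneDirectSum T) := by
  intro l
  rcases l with _ | l
  · refine ⟨{0}, fun m hm => ?_, fun z => ?_⟩
    · rcases m with _ | m
      · simp at hm
      · rfl
    · rw [Finset.sum_singleton, h0]
      exact (mul_one _).symm
  · obtain ⟨s, hs, hy⟩ := h l
    refine ⟨s.map ⟨Nat.succ, Nat.succ_injective⟩, fun m hm => ?_, fun z => ?_⟩
    · rcases m with _ | m
      · rfl
      · exact hs m fun hms => hm (Finset.mem_map_of_mem _ hms)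
    · rw [Finset.sum_map]
      exact hy z

end Expansion

section CMV

variable {μ : MatrixMeasure k} {φ ψ φL φR : ℕ → (Mat k)[X]} {α : ℕ → Mat k}

lemma cmvChi_eq_laurent (φ ψ : ℕ → (Mat k)[X]) (l : ℕ) :
    cmvChi φ ψ l = laurent (-(l / 2 : ℕ)) (if Even l then szegoDual l (ψ l) else φ l) := by
  funext z
  rw [cmvChi, laurent, apply_ite (evalCircle · z)]

lemma cmvX_eq_laurent (φ ψ : ℕ → (Mat k)[X]) (l : ℕ) :
    cmvX φ ψ l = laurent (-((l + 1) / 2 : ℕ)) (if Even l then φ l else szegoDual l (ψ l)) := by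
  funext z
  rw [cmvX, laurent, apply_ite (evalCircle · z)]

lemma continuous_cmvChi (φ ψ : ℕ → (Mat k)[X]) (l : ℕ) : Continuous (cmvChi φ ψ l) :=
  cmvChi_eq_laurent φ ψ l ▸ continuous_laurent _ _

lemma continuous_cmvX (φ ψ : ℕ → (Mat k)[X]) (l : ℕ) : Continuous (cmvX φ ψ l) :=
  cmvX_eq_laurent φ ψ l ▸ continuous_laurent _ _

lemma mulZ_laurent (c : ℤ) (P : (Mat k)[X]) : mulZ (laurent c P) = laurent (c + 1) P := by
  funext z
  rw [mulZ, laurent, laurent, smul_smul, zpow_add_one₀ (Circle.coe_ne_zero z), mul_comm]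

lemma conjTranspose_cmvChi (hφ : ∀ n, (φ n).natDegree ≤ n) (hψ : ∀ n, (ψ n).natDegree ≤ n)
    (l : ℕ) (z : Circle) : (cmvChi φ ψ l z).conjTranspose = cmvX ψ φ l z := by
  rw [cmvChi_eq_laurent, cmvX_eq_laurent]
  split_ifs
  · rw [conjTranspose_laurent (natDegree_szegoDual_le l _), szegoDual_szegoDual (hψ l)]
    congr 1
    omega
  · rw [conjTranspose_laurent (hφ l)]
    congr 1
    omega

lemma conjTranspose_cmvX (hφ : ∀ n, (φ n).natDegree ≤ n) (hψ : ∀ n, (ψ n).natDegree ≤ n)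
    (l : ℕ) (z : Circle) : (cmvX φ ψ l z).conjTranspose = cmvChi ψ φ l z := by
  rw [← conjTranspose_cmvChi hψ hφ, Matrix.conjTranspose_conjTranspose]

lemma cmvExponent_injective : cmvExponent.Injective := by
  intro i j hij
  simp only [cmvExponent, Nat.even_iff] at hij
  split_ifs at hij <;> omega

lemma inModuleSpan_cmvChi (hφ : ∀ n, (φ n).natDegree ≤ n) (l : ℕ) :
    InModuleSpan cmvExponent (l + 1) (cmvChi φ ψ l) := by
  rw [cmvChi_eq_laurent]
  refine inModuleSpan_laurent cmvExponent_injective ?_ fun j hj => ?_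
  · split_ifs
    exacts [natDegree_szegoDual_le l _, hφ l]
  · simp only [cmvExponent, Nat.even_iff]
    split_ifs <;> omega

lemma inModuleSpan_cmvX (hφ : ∀ n, (φ n).natDegree ≤ n) (l : ℕ) :
    InModuleSpan (fun j => -cmvExponent j) (l + 1) (cmvX φ ψ l) := by
  rw [cmvX_eq_laurent]
  refine inModuleSpan_laurent (neg_injective.comp cmvExponent_injective) ?_ fun j hj => ?_
  · split_ifs
    exacts [hφ l, natDegree_szegoDual_le l _]
  · simp only [cmvExponent, Nat.even_iff]
    split_ifs <;> omega

section OPUC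

variable (hL : IsLeftOPUC μ φL) (hR : IsRightOPUC μ φR)

include hL hR

lemma isGramSchmidtSeq_cmvChi : IsGramSchmidtSeq μ cmvExponent (cmvChi φR φL) := by
  have hf := (isRightOPUC_iff.1 hR).isNormalizedResidual
  have hg := ((isLeftOPUC_iff hL.natDegree_le).1 hL).isNormalizedResidual
  refine ⟨inModuleSpan_cmvChi hR.natDegree_le, fun l j hj => ?_, fun l => ?_⟩ <;>
    rw [cmvChi_eq_laurent] <;> split_ifs with hl
  · rw [Nat.even_iff] at hl
    apply (hg l).innerR_laurent_eq_zero <;>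
      simp only [cmvExponent, Nat.even_iff, Finset.mem_Ico] <;> split_ifs <;> omega
  · rw [Nat.even_iff] at hl
    apply (hf l).innerR_laurent_eq_zero <;>
      simp only [cmvExponent, Nat.even_iff, Finset.mem_Ico] <;> split_ifs <;> omega
  · rw [innerR_laurent_laurent, (hg l).innerPoly_self]
  · rw [innerR_laurent_laurent, (hf l).innerPoly_self]

lemma isGramSchmidtSeq_cmvX : IsGramSchmidtSeq μ (fun j => -cmvExponent j) (cmvX φR φL) := by
  have hf := (isRightOPUC_iff.1 hR).isNormalizedResidual
  have hg := ((isLeftOPUC_iff hL.natDegree_le).1 hL).isNormalizedResidual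
  refine ⟨inModuleSpan_cmvX hR.natDegree_le, fun l j hj => ?_, fun l => ?_⟩ <;>
    rw [cmvX_eq_laurent] <;> split_ifs with hl
  · rw [Nat.even_iff] at hl
    apply (hf l).innerR_laurent_eq_zero <;>
      simp only [cmvExponent, Nat.even_iff, Finset.mem_Ico] <;> split_ifs <;> omega
  · rw [Nat.even_iff] at hl
    apply (hg l).innerR_laurent_eq_zero <;>
      simp only [cmvExponent, Nat.even_iff, Finset.mem_Ico] <;> split_ifs <;> omega
  · rw [innerR_laurent_laurent, (hf l).innerPoly_self]
  · rw [innerR_laurent_laurent, (hg l).innerPoly_self]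

lemma innerL_cmvChi (l m : ℕ) :
    innerL μ (cmvChi φL φR l) (cmvChi φL φR m) = if l = m then 1 else 0 := by
  simp only [innerL_eq_innerR, conjTranspose_cmvChi hL.natDegree_le hR.natDegree_le]
  rw [(isGramSchmidtSeq_cmvX hL hR).innerR_eq]
  simp only [eq_comm]

lemma innerL_cmvX (l m : ℕ) :
    innerL μ (cmvX φL φR l) (cmvX φL φR m) = if l = m then 1 else 0 := by
  simp only [innerL_eq_innerR, conjTranspose_cmvX hL.natDegree_le hR.natDegree_le]
  rw [(isGramSchmidtSeq_cmvChi hL hR).innerR_eq]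
  simp only [eq_comm]

lemma cmvChi_zero_eq_cmvX_zero : cmvChi φR φL 0 = cmvX φR φL 0 := by
  have szegoDual_zero : szegoDual 0 (φL 0) = 1 := by
    rw [szegoDual, Finset.sum_range_one, hL.leading_zero, Matrix.conjTranspose_one,
      monomial_zero_one]
  have φR_zero : φR 0 = 1 := by
    rw [eq_C_of_natDegree_le_zero (hR.natDegree_le 0), hR.leading_zero, C_1]
  rw [cmvChi_eq_laurent, cmvX_eq_laurent, if_pos Even.zero, if_pos Even.zero, szegoDual_zero,
    φR_zero]

end OPUC

section Theta

variable (hV : IsVerblunsky φL φR α)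

include hV

lemma IsVerblunsky.laurent_add_one_right (n : ℕ) (c : ℤ) (z : Circle) :
    laurent (c + 1) (φR n) z = laurent c (szegoDual n (φL n)) z * (α n).conjTranspose +
      laurent c (φR (n + 1)) z * rhoR (α n) := by
  rw [← laurent_X_mul, hV.right, laurent_add, laurent_mul_C, laurent_mul_C, add_comm]

lemma IsVerblunsky.laurent_szegoDual_succ (n : ℕ) (c : ℤ) (z : Circle) :
    laurent c (szegoDual (n + 1) (φL (n + 1))) z =
      laurent c (szegoDual n (φL n)) z * rhoL (α n) + laurent c (φR (n + 1)) z * -α n := by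
  rw [mul_neg, ← sub_eq_add_neg, eq_sub_iff_add_eq, ← laurent_mul_C, ← laurent_mul_C,
    ← laurent_add, hV.szegoDual_succ_eq, sub_add_cancel]

lemma isExpansion_blockL :
    IsExpansion (cmvChi φR φL) (fun l => mulZ (cmvX φR φL l)) (blockL α) := by
  refine isExpansion_directSum fun i b z => ?_
  have even : Even (2 * i) := even_two_mul i
  have odd : ¬ Even (2 * i + 1) := by rw [Nat.even_iff]; omega
  have div_even : 2 * i / 2 = i := by omega
  have div_odd : (2 * i + 1) / 2 = i := by omega
  have div_succ : (2 * i + 1 + 1) / 2 = i + 1 := by omega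
  simp only [cmvChi_eq_laurent, cmvX_eq_laurent, mulZ_laurent, if_pos even, if_neg odd, div_even,
    div_odd]
  fin_cases b
  · simp only [Fin.zero_eta, add_zero, if_pos even, div_odd]
    exact hV.laurent_add_one_right (2 * i) (-i) z
  · simp only [Fin.mk_one, if_neg odd, div_succ, Nat.cast_succ, neg_add,
      neg_add_cancel_right]
    exact hV.laurent_szegoDual_succ (2 * i) (-i) z

lemma isExpansion_blockM (h0 : cmvChi φR φL 0 = cmvX φR φL 0) :
    IsExpansion (cmvX φR φL) (cmvChi φR φL) (blockM α) := by
  refine IsExpansion.oneDirectSum h0 (isExpansion_directSum fun i b z => ?_)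
  have even : Even (2 * i + 1 + 1) := by rw [Nat.even_iff]; omega
  have odd : ¬ Even (2 * i + 1) := by rw [Nat.even_iff]; omega
  have div_odd : (2 * i + 1) / 2 = i := by omega
  have div_succ : (2 * i + 1 + 1) / 2 = i + 1 := by omega
  have div_succ_succ : (2 * i + 1 + 1 + 1) / 2 = i + 1 := by omega
  simp only [cmvChi_eq_laurent, cmvX_eq_laurent, if_pos even, if_neg odd, div_succ, div_succ_succ]
  fin_cases b
  · simp only [Fin.zero_eta, add_zero, if_neg odd, div_odd]
    rw [show (-i : ℤ) = -(i + 1 : ℕ) + 1 by omega]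
    exact hV.laurent_add_one_right (2 * i + 1) _ z
  · simp only [Fin.mk_one, if_pos even, div_succ]
    exact hV.laurent_szegoDual_succ (2 * i + 1) _ z

end Theta

section Factorization

lemma continuous_mulZ {f : Circle → Mat k} (hf : Continuous f) : Continuous (mulZ f) :=
  continuous_subtype_val.smul hf

variable (hL : IsLeftOPUC μ φL) (hR : IsRightOPUC μ φR) (hV : IsVerblunsky φL φR α)

include hL hR hV

lemma gramR_cmvChi_mulZ_cmvX :
    gramR μ (cmvChi φR φL) (fun l => mulZ (cmvX φR φL l)) = blockL α :=
  (isExpansion_blockL hV).gramR_eq (continuous_cmvChi φR φL)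
    (isGramSchmidtSeq_cmvChi hL hR).innerR_eq

lemma gramR_cmvX_cmvChi : gramR μ (cmvX φR φL) (cmvChi φR φL) = blockM α :=
  (isExpansion_blockM hV (cmvChi_zero_eq_cmvX_zero hL hR)).gramR_eq (continuous_cmvX φR φL)
    (isGramSchmidtSeq_cmvX hL hR).innerR_eq

lemma isBlockProduct_gramR_cmvChi :
    IsBlockProduct (gramR μ (cmvChi φR φL) fun l => mulZ (cmvChi φR φL l)) (blockL α)
      (blockM α) := by
  rw [← gramR_cmvChi_mulZ_cmvX hL hR hV]
  exact (isExpansion_blockM hV (cmvChi_zero_eq_cmvX_zero hL hR)).mulZ.isBlockProduct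
    (fun m => continuous_mulZ (continuous_cmvX φR φL m)) (continuous_cmvChi φR φL)

lemma isBlockProduct_gramR_cmvX :
    IsBlockProduct (gramR μ (cmvX φR φL) fun l => mulZ (cmvX φR φL l)) (blockM α)
      (blockL α) := by
  rw [← gramR_cmvX_cmvChi hL hR hV]
  exact (isExpansion_blockL hV).isBlockProduct (continuous_cmvChi φR φL) (continuous_cmvX φR φL)

end Factorization

section Left

variable {u v u' v' : ℕ → Circle → Mat k}

lemma gramL_eq_gramR (hu : ∀ l z, (u l z).conjTranspose = u' l z)
    (hv : ∀ l z, (v l z).conjTranspose = v' l z) : gramL μ u v = gramR μ v' u' := by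
  simp only [gramL, gramR, innerL_eq_innerR, hu, hv]

lemma innerR_conjTranspose_mulZ (f g : Circle → Mat k) :
    innerR μ (fun z => (mulZ f z).conjTranspose) g =
      innerR μ (fun z => (f z).conjTranspose) (mulZ g) := by
  have conjTranspose_mulZ (z : Circle) :
      (mulZ f z).conjTranspose = (z : ℂ) ^ (-1 : ℤ) • (f z).conjTranspose := by
    rw [mulZ, Matrix.conjTranspose_smul, ← star_circle_zpow, zpow_one]
  have shift := innerR_zpow_smul_of_sub_eq (μ := μ) (a := -1) (b := 0) (c := 0) (d := 1)
    (by norm_num) (fun z => (f z).conjTranspose) g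
  simp only [zpow_zero, one_smul, zpow_one] at shift
  simp only [conjTranspose_mulZ]
  exact shift

lemma gramL_mulZ_eq_gramR (hu : ∀ l z, (u l z).conjTranspose = u' l z)
    (hv : ∀ l z, (v l z).conjTranspose = v' l z) :
    gramL μ u (fun l => mulZ (v l)) = gramR μ v' fun l => mulZ (u' l) := by
  simp only [gramL, gramR, innerL_eq_innerR, innerR_conjTranspose_mulZ, hu, hv]

end Left

end CMV

end MatrixCMV

end

theorem theorem4p2 (k : ℕ) (μ : MatrixCMV.MatrixMeasure k) (hμ : μ.Nontrivial) :
    (∃! φL : ℕ → (MatrixCMV.Mat k)[X], MatrixCMV.IsLeftOPUC μ φL) ∧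
    (∃! φR : ℕ → (MatrixCMV.Mat k)[X], MatrixCMV.IsRightOPUC μ φR) ∧
    ∀ φL φR : ℕ → (MatrixCMV.Mat k)[X],
      MatrixCMV.IsLeftOPUC μ φL → MatrixCMV.IsRightOPUC μ φR →
      (∃! α : ℕ → MatrixCMV.Mat k, MatrixCMV.IsVerblunsky φL φR α) ∧
      ∀ α : ℕ → MatrixCMV.Mat k, MatrixCMV.IsVerblunsky φL φR α →
      ∀ χL xL χR xR : ℕ → Circle → MatrixCMV.Mat k,
      χL = MatrixCMV.cmvChi φL φR → xL = MatrixCMV.cmvX φL φR →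
      χR = MatrixCMV.cmvChi φR φL → xR = MatrixCMV.cmvX φR φL →
      -- orthonormality of the left-handed and of the right-handed families
      (∀ l m, MatrixCMV.innerL μ (χL l) (χL m) = if l = m then 1 else 0) ∧
      (∀ l m, MatrixCMV.innerL μ (xL l) (xL m) = if l = m then 1 else 0) ∧
      (∀ l m, MatrixCMV.innerR μ (χR l) (χR m) = if l = m then 1 else 0) ∧
      (∀ l m, MatrixCMV.innerR μ (xR l) (xR m) = if l = m then 1 else 0) ∧
      -- module spans
      (∀ l, MatrixCMV.InModuleSpan MatrixCMV.cmvExponent (l + 1) (χL l) ∧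
        MatrixCMV.InModuleSpan (fun j => -MatrixCMV.cmvExponent j) (l + 1) (xL l) ∧
        MatrixCMV.InModuleSpan MatrixCMV.cmvExponent (l + 1) (χR l) ∧
        MatrixCMV.InModuleSpan (fun j => -MatrixCMV.cmvExponent j) (l + 1) (xR l)) ∧
      -- unitarity of the blocks
      (∀ n, MatrixCMV.thetaFull (α n) ∈ Matrix.unitaryGroup (Fin 2 × Fin k) ℂ) ∧
      -- the factors and the factorization, right-handed
      MatrixCMV.gramR μ χR (fun l => MatrixCMV.mulZ (xR l)) = MatrixCMV.blockL α ∧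
      MatrixCMV.gramR μ xR χR = MatrixCMV.blockM α ∧
      MatrixCMV.IsBlockProduct (MatrixCMV.gramR μ χR (fun l => MatrixCMV.mulZ (χR l)))
        (MatrixCMV.gramR μ χR (fun l => MatrixCMV.mulZ (xR l))) (MatrixCMV.gramR μ xR χR) ∧
      -- the factors and the factorizations, left-handed
      MatrixCMV.gramL μ χL (fun l => MatrixCMV.mulZ (xL l)) = MatrixCMV.blockL α ∧
      MatrixCMV.gramL μ xL χL = MatrixCMV.blockM α ∧
      MatrixCMV.IsBlockProduct (MatrixCMV.gramL μ xL (fun l => MatrixCMV.mulZ (xL l)))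
        (MatrixCMV.gramL μ χL (fun l => MatrixCMV.mulZ (xL l))) (MatrixCMV.gramL μ xL χL) ∧
      MatrixCMV.IsBlockProduct (MatrixCMV.gramL μ χL (fun l => MatrixCMV.mulZ (χL l)))
        (MatrixCMV.gramL μ xL χL) (MatrixCMV.gramL μ χL (fun l => MatrixCMV.mulZ (xL l))) := by
  obtain ⟨φL, φR, α, hL, hR, hV⟩ := MatrixCMV.exists_isVerblunsky hμ
  refine ⟨⟨φL, hL, fun φ hφ => hφ.unique hμ hL⟩, ⟨φR, hR, fun φ hφ => hφ.unique hμ hR⟩, ?_⟩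
  intro φL' φR' hL' hR'
  obtain rfl := hL'.unique hμ hL
  obtain rfl := hR'.unique hμ hR
  refine ⟨⟨α, hV, fun β hβ => hβ.unique hL hR hV⟩, ?_⟩
  rintro β hβ _ _ _ _ rfl rfl rfl rfl
  obtain rfl := hβ.unique hL hR hV
  have hχ := MatrixCMV.conjTranspose_cmvChi hL.natDegree_le hR.natDegree_le
  have hx := MatrixCMV.conjTranspose_cmvX hL.natDegree_le hR.natDegree_le
  rw [MatrixCMV.gramL_mulZ_eq_gramR hχ hx, MatrixCMV.gramL_eq_gramR hx hχ,
    MatrixCMV.gramL_mulZ_eq_gramR hx hx, MatrixCMV.gramL_mulZ_eq_gramR hχ hχ,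
    MatrixCMV.gramR_cmvChi_mulZ_cmvX hL hR hV, MatrixCMV.gramR_cmvX_cmvChi hL hR hV]
  have hLM := MatrixCMV.isBlockProduct_gramR_cmvChi hL hR hV
  have hML := MatrixCMV.isBlockProduct_gramR_cmvX hL hR hV
  have hχR := MatrixCMV.isGramSchmidtSeq_cmvChi hL hR
  have hxR := MatrixCMV.isGramSchmidtSeq_cmvX hL hR
  exact ⟨MatrixCMV.innerL_cmvChi hL hR, MatrixCMV.innerL_cmvX hL hR, hχR.innerR_eq, hxR.innerR_eq,
    fun l => ⟨MatrixCMV.inModuleSpan_cmvChi hL.natDegree_le l,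
      MatrixCMV.inModuleSpan_cmvX hL.natDegree_le l, hχR.inModuleSpan l, hxR.inModuleSpan l⟩,
    fun n => MatrixCMV.thetaFull_mem_unitaryGroup (hV.norm_lt_one n),
    rfl, rfl, hLM, rfl, rfl, hLM, hML⟩
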